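/- **Setting.** Let $c,b,q,h$ and $A,T,W,M$ be real vectors and matrices of compatible sizes. Let $\mathcal X=\{x: Ax\le q\}$, where prescribed components of $x$ may also be required to be binary, and assume $\mathcal X\neq\emptyset$. Let $\mathcal V_k=\{v: D_kv\le d_k\}$, $k=1,\dots,K$, be nonempty bounded polytopes. Assume relatively complete recourse with finite cost: for all $x\in\mathcal X$, $v\in\bigcup_k\mathcal V_k$, the linear program $\min_y\{b^{\mathsf T}y: Tx+Wy+Mv\le h\}$ is feasible and bounded below. Put $\mathcal C_k(x)=\max_{v\in\mathcal V_k}\min_y\{b^{\mathsf T}y: Tx+Wy+Mv\le h\}$. Let $\bar p$ be a probability vector, let $\rho\ge0$, and let $$\mathcal P=\Big\{p\ge0:\ \textstyle\sum_kp_k=1,\ \sum_kp_k\log(p_k/\bar p_k)\le\rho\Big\}$$ (with $0\log(0/\cdot)=0$, and divergence $+\infty$ if $p_k>0=\bar p_k$ for some $k$). The distributionally robust problem is $$\text{(P)}\qquad \min_{x,\eta}\ c^{\mathsf T}x+\eta\quad\text{s.t.}\quad x\in\mathcal X,\quad \max_{p\in\mathcal P}\sum_kp_k\,\mathcal C_k(x)\le\eta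 .$$ For $s\in\mathbb R^K$, $\mu\in\mathbb R$, $\nu\ge0$ put $G(s,\mu,\nu)=\mu+\rho\nu+\nu\sum_k\bar p_k\exp\big(\frac{s_k-\mu}{\nu}-1\big)$, where for $\nu=0$ the expression $\nu\exp(\frac t\nu-1)$ means $0$ if $t\le0$ and $+\infty$ if $t>0$, and $0\cdot\infty=0$. **Algorithm** (tolerance $\epsilon\ge0$). Set $LB=-\infty$, $UB=+\infty$. While $|UB-LB|>\epsilon$, perform iteration $r=0,1,2,\dots$: 1. Solve the master problem: minimise $c^{\mathsf T}x+\eta$ over $x\in\mathcal X$, $\eta,\mu\in\mathbb R$, $\nu\ge0$ and $(y_{k,i})_{k\le K,\,i<r}$, subject to $G((b^{\mathsf T}y_{k,i})_k,\mu,\nu)\le\eta$ and $Tx+Wy_{k,i}+Mv^*_{k,i}\le h$ for all $i<r$ and all $k$. This gives $(x^*,\eta^*,\mu^*,\nu^*)$; set $LB=c^{\mathsf T}x^*+\eta^*$. (For $r=0$ there are no cuts and the master problem is unbounded below: any feasible point is taken and $LB$ stays $-\infty$.) 2. For each $k$ find an optimal solution $(v_k^*,y_k^*)$ of the subproblem $\max_{v\in\mathcal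 V_k}\min_y\{b^{\mathsf T}y: Tx^*+Wy+Mv\le h\}$. Set $UB=\min\{UB,\ c^{\mathsf T}x^*+G((b^{\mathsf T}y_k^*)_k,\mu^*,\nu^*)\}$ and $v^*_{k,r}=v^*_k$ for all $k$. After the loop, return the $x^*$ of an iteration that attains $UB$, and the value $c^{\mathsf T}x^*+\eta^*$ of the last master problem. **Theorem.** (a) For $x\in\mathcal X$ the subproblems have optimal solutions, with value $\mathcal C_k(x)$, and $\max_{p\in\mathcal P}\sum_kp_k\mathcal C_k(x)=\inf_{\mu\in\mathbb R,\,\nu\ge0}G((\mathcal C_k(x))_k,\mu,\nu)$. If $\rho>0$, then for every $\eta\in\mathbb R$: $\max_{p\in\mathcal P}\sum_kp_k\mathcal C_k(x)\le\eta$ if and only if $G((\mathcal C_k(x))_k,\mu,\nu)\le\eta$ for some $\mu\in\mathbb R$, $\nu\ge0$. (b) There is a number $N$, depending only on the data of the problem, such that the algorithm performs at most $N$ iterations, for every $\epsilon\ge0$ and every choice of the optimal solutions in steps 1 and 2. (c) While $|UB-LB|>\epsilon$, the algorithm can perform its next iteration whenever the current master problem has an optimal solution or has no cuts ($r=0$).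 If $\rho>0$ and $\mathcal X$ is bounded, every master problem with $r\ge1$ met by the algorithm has an optimal solution. (d) When the loop ends, the algorithm returns some $x$ and a value $z$. Whatever it returns satisfies: there is $\eta$ such that $(x,\eta)$ is feasible for (P), its objective is at most $z+\epsilon$ and exceeds the objective of no feasible pair by more than $\epsilon$; and $z\le\operatorname{val}(\mathrm P)\le z+\epsilon$, where $\operatorname{val}(\mathrm P)$ is the infimum of (P). In particular, for $\epsilon=0$ the pair $(x,\eta)$ is an optimal solution of (P) and $z$ is its optimal value. -/

import Mathlib

open scoped Matrix

noncomputable section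

/-- The data of a two-stage linear robust problem whose uncertainty set is a union of `K`
polyhedra, together with a nominal probability vector and a radius for the ambiguity set.
The components of the first-stage decision listed in `binary` are restricted to `0` and `1`. -/
structure TwoStageDRO where
  nx : ℕ
  ny : ℕ
  nv : ℕ
  nA : ℕ
  nh : ℕ
  K : ℕ
  rows : Fin K → ℕ
  binary : Set (Fin nx)
  c : Fin nx → ℝ
  b : Fin ny → ℝ
  q : Fin nA → ℝ
  h : Fin nh → ℝ
  A : Matrix (Fin nA) (Fin nx) ℝ
  T : Matrix (Fin nh) (Fin nx) ℝ
  W : Matrix (Fin nh) (Fin ny) ℝ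
  M : Matrix (Fin nh) (Fin nv) ℝ
  Dmat : (k : Fin K) → Matrix (Fin (rows k)) (Fin nv) ℝ
  dvec : (k : Fin K) → Fin (rows k) → ℝ
  pbar : Fin K → ℝ
  rho : ℝ

/-- The Kullback-Leibler divergence `∑ k, p k * log (p k / r k)` of finite probability vectors,
with `0 * log (0 / r) = 0`, and `+∞` when `p` is not absolutely continuous with respect to `r`. -/
def klVec {K : ℕ} (p r : Fin K → ℝ) : EReal :=
  open Classical in
  if ∀ k, r k = 0 → p k = 0 then ((∑ k, p k * Real.log (p k / r k) : ℝ) : EReal) else ⊤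

/-- The function `ν * exp (t / ν - 1)` for `ν > 0`, extended to `ν = 0` by lower
semicontinuity: it is then `0` for `t ≤ 0` and `+∞` for `t > 0`. -/
def expPersp (ν t : ℝ) : EReal :=
  if 0 < ν then ((ν * Real.exp (t / ν - 1) : ℝ) : EReal) else if t ≤ 0 then 0 else ⊤

namespace TwoStageDRO

variable (D : TwoStageDRO)

/-- The first-stage decisions `x` with `A x ≤ q` and binary components where required. -/
def firstStage : Set (Fin D.nx → ℝ) :=
  {x | D.A *ᵥ x ≤ D.q ∧ ∀ j ∈ D.binary, x j = 0 ∨ x j = 1}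

/-- The `k`-th uncertainty subset. -/
def uncSet (k : Fin D.K) : Set (Fin D.nv → ℝ) := {v | D.Dmat k *ᵥ v ≤ D.dvec k}

/-- The recourse decisions that are feasible for `x` and `v`. -/
def recourse (x : Fin D.nx → ℝ) (v : Fin D.nv → ℝ) : Set (Fin D.ny → ℝ) :=
  {y | D.T *ᵥ x + D.W *ᵥ y + D.M *ᵥ v ≤ D.h}

/-- The value of the recourse problem `min_y b y`. -/
def recourseCost (x : Fin D.nx → ℝ) (v : Fin D.nv → ℝ) : EReal :=
  ⨅ y ∈ D.recourse x v, ((D.b ⬝ᵥ y : ℝ) : EReal)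

/-- The worst recourse cost over the `k`-th subset, `max_{v ∈ V_k} min_y b y`. -/
def worstCost (x : Fin D.nx → ℝ) (k : Fin D.K) : EReal :=
  ⨆ v ∈ D.uncSet k, D.recourseCost x v

/-- The ambiguity set of subset-membership probabilities. -/
def ambiguity : Set (Fin D.K → ℝ) :=
  {p | (∀ k, 0 ≤ p k) ∧ ∑ k, p k = 1 ∧ klVec p D.pbar ≤ (D.rho : EReal)}

/-- The worst expectation, over the ambiguity set, of the worst recourse costs. -/
def robustCost (x : Fin D.nx → ℝ) : EReal :=
  ⨆ p ∈ D.ambiguity, ∑ k, (p k : EReal) * D.worstCost x k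

/-- Feasibility of `(x, η)` in the epigraph form of the distributionally robust problem. -/
def Feasible (x : Fin D.nx → ℝ) (η : ℝ) : Prop :=
  x ∈ D.firstStage ∧ D.robustCost x ≤ (η : EReal)

/-- The optimal value of the distributionally robust problem, `inf c x + η`. -/
def optValue : EReal :=
  ⨅ (x : Fin D.nx → ℝ) (η : ℝ) (_ : D.Feasible x η), ((D.c ⬝ᵥ x + η : ℝ) : EReal)

/-- `(x, η)` is feasible for the distributionally robust problem and its objective exceeds that
of any other feasible pair by at most `ε`; for `ε = 0` it is an optimal solution. -/
def IsEpsOptimal (ε : ℝ) (x : Fin D.nx → ℝ) (η : ℝ) : Prop :=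
  D.Feasible x η ∧ ∀ x' η', D.Feasible x' η' → D.c ⬝ᵥ x + η ≤ D.c ⬝ᵥ x' + η' + ε

/-- The dual expression `μ + ρ ν + ν ∑ k, pbar k * exp ((s k - μ) / ν - 1)`. -/
def dualCost (s : Fin D.K → ℝ) (μ ν : ℝ) : EReal :=
  ((μ + D.rho * ν : ℝ) : EReal) + ∑ k, (D.pbar k : EReal) * expPersp ν (s k - μ)

/-- Feasibility in the master problem with the scenario tuples `cut i`, `i < r`; the decision
variables are `x, η, μ, ν` and the recourse vectors `y i k`, `i < r`. -/
def MasterFeasible (r : ℕ) (cut : ℕ → Fin D.K → Fin D.nv → ℝ) (x : Fin D.nx → ℝ) (η μ ν : ℝ)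
    (y : ℕ → Fin D.K → Fin D.ny → ℝ) : Prop :=
  x ∈ D.firstStage ∧ 0 ≤ ν ∧
    (∀ i < r, D.dualCost (fun k => D.b ⬝ᵥ y i k) μ ν ≤ (η : EReal)) ∧
    ∀ i < r, ∀ k, D.T *ᵥ x + D.W *ᵥ y i k + D.M *ᵥ cut i k ≤ D.h

/-- `(x, η, μ, ν)` is the corresponding part of an optimal solution of the master problem. -/
def MasterOptimal (r : ℕ) (cut : ℕ → Fin D.K → Fin D.nv → ℝ) (x : Fin D.nx → ℝ)
    (η μ ν : ℝ) : Prop :=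
  (∃ y, D.MasterFeasible r cut x η μ ν y) ∧
    ∀ x' η' μ' ν' y', D.MasterFeasible r cut x' η' μ' ν' y' →
      D.c ⬝ᵥ x + η ≤ D.c ⬝ᵥ x' + η'

/-- What it means that the master problem returns `(x, η, μ, ν)`. Without any cut the master
problem is unbounded below (`η` is free), and then any feasible point may be returned. -/
def MasterReturns (r : ℕ) (cut : ℕ → Fin D.K → Fin D.nv → ℝ) (x : Fin D.nx → ℝ)
    (η μ ν : ℝ) : Prop :=
  if r = 0 then ∃ y, D.MasterFeasible r cut x η μ ν y else D.MasterOptimal r cut x η μ ν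

/-- `(v, y)` is an optimal solution of the `k`-th max-min subproblem at `x`. -/
def SubOptimal (x : Fin D.nx → ℝ) (k : Fin D.K) (v : Fin D.nv → ℝ) (y : Fin D.ny → ℝ) : Prop :=
  v ∈ D.uncSet k ∧ y ∈ D.recourse x v ∧
    (∀ y' ∈ D.recourse x v, D.b ⬝ᵥ y ≤ D.b ⬝ᵥ y') ∧
    ∀ v' ∈ D.uncSet k, D.recourseCost x v' ≤ ((D.b ⬝ᵥ y : ℝ) : EReal)

/-- What one iteration of the algorithm computes: the master solution and the solutions of the
`K` subproblems. -/
structure Iterate (D : TwoStageDRO) where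
  x : Fin D.nx → ℝ
  η : ℝ
  μ : ℝ
  ν : ℝ
  v : Fin D.K → Fin D.nv → ℝ
  y : Fin D.K → Fin D.ny → ℝ

/-- The lower bound after `n` iterations: `-∞` initially and after the master problem without
cuts, and then the objective value of the last master solution. -/
def LB (t : ℕ → D.Iterate) : ℕ → EReal
  | 0 => ⊥
  | r + 1 => if r = 0 then ⊥ else ((D.c ⬝ᵥ (t r).x + (t r).η : ℝ) : EReal)

/-- The new upper bound computed in an iteration. -/
def candidate (z : D.Iterate) : EReal :=
  ((D.c ⬝ᵥ z.x : ℝ) : EReal) + D.dualCost (fun k => D.b ⬝ᵥ z.y k) z.μ z.ν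

/-- The upper bound after `n` iterations. -/
def UB (t : ℕ → D.Iterate) : ℕ → EReal
  | 0 => ⊤
  | r + 1 => min (UB t r) (D.candidate (t r))

/-- The loop condition `|UB - LB| > ε` after `n` iterations. -/
def GapOpen (ε : ℝ) (t : ℕ → D.Iterate) (n : ℕ) : Prop :=
  ENNReal.ofReal ε < (D.UB t n - D.LB t n).abs

/-- The first `n` entries of `t` are `n` consecutive iterations of the column-and-constraint
generation algorithm with gap `ε`: each is entered because the loop condition holds, solves the
master problem with the scenarios of all previous iterations, and then the `K` subproblems. -/
def IsRun (ε : ℝ) (n : ℕ) (t : ℕ → D.Iterate) : Prop :=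
  ∀ r < n, D.GapOpen ε t r ∧
    D.MasterReturns r (fun i => (t i).v) (t r).x (t r).η (t r).μ (t r).ν ∧
    ∀ k, D.SubOptimal (t r).x k ((t r).v k) ((t r).y k)

/-- The algorithm stops after the `n` iterations `t` and returns the first-stage decision `x`
of an iteration that attains the upper bound, and the objective value `val` of the last master
problem. -/
def Returns (ε : ℝ) (n : ℕ) (t : ℕ → D.Iterate) (x : Fin D.nx → ℝ) (val : ℝ) : Prop :=
  D.IsRun ε n t ∧ ¬ D.GapOpen ε t n ∧ D.LB t n = (val : EReal) ∧
    ∃ j < n, D.UB t n = D.candidate (t j) ∧ x = (t j).x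

end TwoStageDRO

end

open scoped Matrix

noncomputable section

/-! Termination rests on linear programming duality. The dual feasible set `l ≥ 0`, `l ᵥ* W = -b` of
the recourse problem depends neither on `x` nor on `v`, so for admissible `x` and `v` the recourse
cost is the maximum of `-(l ⬝ᵥ (h - T x - M v))` over the finitely many dual vertices `l`
(`exists_optimal_dualVertex`, `finite_dualVertices`). In each of these functions `x` and `v` are
separated. Hence, if the worst scenarios of two iterations `i < r` are certified by the same tuple
of vertices, those of `i` are also worst at the decision of `r` (`dotProduct_le_of_common_vertex`).
The master problem of `r` already contains them, so the bounds meet (`candidate_le_LB`), and the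
pigeonhole principle bounds the number of iterations (`le_card`).

Correctness rests on duality over the divergence ball. Young's inequality writes `dualCost` as a
supremum of affine functions and gives weak duality. For strong duality, the Gibbs distribution with
parameter `t` has a multiplier whose dual value exceeds its mean by `(rho - entropy) / t`, and `t`
is chosen to make this excess small. For `rho > 0` the sublevel sets in `(μ, ν)` are compact and the
infimum is attained; for `rho = 0` it need not be, so the general arguments carry an error `δ`.
Every master problem relaxes the dual reformulation, which makes `LB` a lower bound; every finite
candidate in `UB` comes from a dual point for the true worst costs, which makes it an upper bound.
-/

/-! ### Finitely generated cones and Farkas' lemma -/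

/-- The ratio test: the largest step along `-g` that keeps `c` nonnegative on `s`. -/
theorem Finset.exists_ratio_test {ι : Type*} (s : Finset ι) (c g : ι → ℝ)
    (hc : ∀ i ∈ s, 0 ≤ c i) (hg : ∃ i ∈ s, 0 < g i) :
    ∃ θ : ℝ, 0 ≤ θ ∧ (∃ i ∈ s, 0 < g i ∧ c i = θ * g i) ∧ ∀ i ∈ s, θ * g i ≤ c i := by
  classical
  have hne : (s.filter fun i => 0 < g i).Nonempty := by
    obtain ⟨i, hi, hgi⟩ := hg
    exact ⟨i, by simp [hi, hgi]⟩
  obtain ⟨i, hi, hmin⟩ := Finset.exists_min_image _ (fun i => c i / g i) hne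
  simp only [Finset.mem_filter] at hi hmin
  have hθ : 0 ≤ c i / g i := div_nonneg (hc i hi.1) hi.2.le
  refine ⟨c i / g i, hθ, ⟨i, hi.1, hi.2, by field_simp [hi.2.ne']⟩, fun j hj => ?_⟩
  rcases lt_or_ge 0 (g j) with h | h
  · exact (le_div_iff₀ h).1 (hmin j ⟨hj, h⟩)
  · exact (mul_nonpos_of_nonneg_of_nonpos hθ h).trans (hc j hj)

/-- Carathéodory's theorem for cones. -/
theorem exists_linearIndepOn_nonneg_sum_eq {ι E : Type*} [AddCommGroup E] [Module ℝ E]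
    (a : ι → E) (s : Finset ι) (c : ι → ℝ) (hc : ∀ i ∈ s, 0 ≤ c i) :
    ∃ t ⊆ s, LinearIndepOn ℝ a (t : Set ι) ∧
      ∃ c' : ι → ℝ, (∀ i ∈ t, 0 ≤ c' i) ∧ ∑ i ∈ t, c' i • a i = ∑ i ∈ s, c i • a i := by
  classical
  induction s using Finset.strongInduction generalizing c with
  | H s ih =>
  by_cases hs : LinearIndepOn ℝ a (s : Set ι)
  · exact ⟨s, subset_rfl, hs, c, hc, rfl⟩
  have hpos : ∃ g : ι → ℝ, ∑ i ∈ s, g i • a i = 0 ∧ ∃ i ∈ s, 0 < g i := by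
    rw [linearIndepOn_finset_iff] at hs
    push Not at hs
    obtain ⟨g, hg, i, hi, hne⟩ := hs
    rcases lt_or_gt_of_ne hne with h | h
    · exact ⟨fun i => -g i, by simp [hg], i, hi, by simpa using h⟩
    · exact ⟨g, hg, i, hi, h⟩
  obtain ⟨g, hg, hgpos⟩ := hpos
  obtain ⟨θ, -, ⟨i, hi, -, hci⟩, hle⟩ := s.exists_ratio_test c g hc hgpos
  obtain ⟨t, hts, hti, c', hc', hsum⟩ := ih (s.erase i) (Finset.erase_ssubset hi)
    (fun j => c j - θ * g j) fun j hj => sub_nonneg.2 (hle j (Finset.mem_of_mem_erase hj))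
  refine ⟨t, hts.trans (s.erase_subset i), hti, c', hc', hsum.trans ?_⟩
  have : ∑ j ∈ s, (c j - θ * g j) • a j = ∑ j ∈ s, c j • a j := by
    simp only [sub_smul, Finset.sum_sub_distrib, mul_smul, ← Finset.smul_sum, hg, smul_zero,
      sub_zero]
  rw [← this, ← Finset.add_sum_erase s _ hi]
  simp [hci]

/-- The conic hull of finitely many vectors. -/
def conicSpan {ι E : Type*} [AddCommGroup E] [Module ℝ E] (a : ι → E) (s : Finset ι) : Set E :=
  {x | ∃ c : ι → ℝ, (∀ i ∈ s, 0 ≤ c i) ∧ ∑ i ∈ s, c i • a i = x}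

theorem convex_conicSpan {ι E : Type*} [AddCommGroup E] [Module ℝ E] (a : ι → E)
    (s : Finset ι) : Convex ℝ (conicSpan a s) := by
  rintro _ ⟨c, hc, rfl⟩ _ ⟨c', hc', rfl⟩ α β hα hβ -
  refine ⟨fun i => α * c i + β * c' i, fun i hi => ?_, ?_⟩
  · have := hc i hi
    have := hc' i hi
    positivity
  · simp only [add_smul, mul_smul, Finset.sum_add_distrib, Finset.smul_sum]

/-- Independence makes the coefficient map an injective linear map of finite-dimensional spaces,
hence a closed embedding; the cone is the image of the closed orthant. -/
theorem isClosed_conicSpan_of_linearIndepOn {ι : Type*} {n : Type*} [Fintype n]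
    (a : ι → n → ℝ) (s : Finset ι) (h : LinearIndepOn ℝ a (s : Set ι)) :
    IsClosed (conicSpan a s) := by
  classical
  let L : (s → ℝ) →ₗ[ℝ] (n → ℝ) := Fintype.linearCombination ℝ (fun i : s => a i)
  have hL : Function.Injective L := by
    have h' : LinearIndependent ℝ (fun i : s => a i) := h
    exact h'.fintypeLinearCombination_injective
  have hemb := LinearMap.isClosedEmbedding_of_injective (LinearMap.ker_eq_bot.2 hL)
  have hset : conicSpan a s = L '' {c | ∀ i, 0 ≤ c i} := by
    ext x
    constructor
    · rintro ⟨c, hc, rfl⟩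
      refine ⟨fun i => c i, fun i => hc i i.2, ?_⟩
      simp only [L, Fintype.linearCombination_apply]
      exact Finset.sum_coe_sort s (fun i => c i • a i)
    · rintro ⟨c, hc, rfl⟩
      refine ⟨fun i => if hi : i ∈ s then c ⟨i, hi⟩ else 0, fun i hi => by simpa [hi] using hc _, ?_⟩
      simp only [L, Fintype.linearCombination_apply]
      rw [← Finset.sum_coe_sort]
      simp
  rw [hset]
  refine hemb.isClosedMap _ ?_
  simp only [Set.ofPred_forall]
  exact isClosed_iInter fun i => isClosed_le continuous_const (continuous_apply i)

/-- By Carathéodory the cone is the finite union of the cones over its independent subfamilies. -/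
theorem isClosed_conicSpan {ι : Type*} {n : Type*} [Fintype n]
    (a : ι → n → ℝ) (s : Finset ι) : IsClosed (conicSpan a s) := by
  classical
  have : conicSpan a s = ⋃ t ∈ {t | t ∈ s.powerset ∧ LinearIndepOn ℝ a (t : Set ι)},
      conicSpan a t := by
    ext x
    simp only [Set.mem_iUnion, Set.mem_ofPred_eq, Finset.mem_powerset, exists_prop]
    constructor
    · rintro ⟨c, hc, rfl⟩
      obtain ⟨t, hts, hti, c', hc', hsum⟩ := exists_linearIndepOn_nonneg_sum_eq a s c hc
      exact ⟨t, ⟨hts, hti⟩, c', hc', hsum⟩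
    · rintro ⟨t, ⟨hts, -⟩, c, hc, rfl⟩
      refine ⟨fun i => if i ∈ t then c i else 0, fun i _ => ?_, ?_⟩
      · by_cases hi : i ∈ t <;> simp [hi]
        exact hc i hi
      · simp only [ite_smul, zero_smul, Finset.sum_ite_mem, Finset.inter_eq_right.2 hts]
  rw [this]
  refine Set.Finite.isClosed_biUnion ?_ fun t ht => isClosed_conicSpan_of_linearIndepOn a t ht.2
  exact s.powerset.finite_toSet.subset fun t ht => ht.1

/-- Farkas' lemma for finitely many vectors. -/
theorem mem_conicSpan_of_forall_dotProduct {ι : Type*} {n : Type*} [Fintype n]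
    (a : ι → n → ℝ) (s : Finset ι) (b : n → ℝ)
    (h : ∀ z : n → ℝ, (∀ i ∈ s, 0 ≤ a i ⬝ᵥ z) → 0 ≤ b ⬝ᵥ z) : b ∈ conicSpan a s := by
  classical
  by_contra hb
  obtain ⟨f, u, hfb, hf⟩ := geometric_hahn_banach_point_closed (convex_conicSpan a s)
    (isClosed_conicSpan a s) hb
  let z : n → ℝ := fun j => f (Pi.single j 1)
  have hz : ∀ x : n → ℝ, f x = x ⬝ᵥ z := fun x => by
    conv_lhs => rw [pi_eq_sum_univ' x]
    simp [dotProduct, z]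
  have hu : u < 0 := by
    simpa using hf 0 ⟨0, by simp, by simp⟩
  have hbz : 0 ≤ b ⬝ᵥ z := by
    refine h z fun i hi => ?_
    by_contra hneg
    rw [not_le, ← hz] at hneg
    -- The factor `u / f (a i)` is positive, and on this multiple of `a i` the functional equals
    -- `u`, although it exceeds `u` on the whole cone.
    have := hf ((u / f (a i)) • a i) ⟨fun j => if j = i then u / f (a i) else 0, fun j _ => by
      by_cases hj : j = i <;> simp [hj]
      exact (div_pos_of_neg_of_neg hu hneg).le, by simp [hi]⟩
    rw [map_smul, smul_eq_mul, div_mul_cancel₀ _ hneg.ne] at this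
    exact lt_irrefl _ this
  rw [← hz] at hbz
  linarith

/-! ### Linear programming duality with dual vertices -/

namespace Matrix

variable {m n : Type*} [Fintype m]

/-- The basic feasible solutions of the dual linear program. -/
def dualVertices (W : Matrix m n ℝ) (b : n → ℝ) : Set (m → ℝ) :=
  {l | 0 ≤ l ∧ l ᵥ* W = -b ∧ LinearIndepOn ℝ (fun i => W i) (Function.support l)}

/-- A vertex is determined by its support: the difference of two vertices with equal support is a
linear relation among independent rows. -/
theorem finite_dualVertices (W : Matrix m n ℝ) (b : n → ℝ) : (dualVertices W b).Finite := by
  classical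
  refine Set.Finite.of_finite_image (f := Function.support) (Set.toFinite _) ?_
  rintro l ⟨-, hl, hli⟩ l' ⟨-, hl', -⟩ hsupp
  have hsub : ∀ i, i ∉ (Function.support l).toFinset → l i = 0 ∧ l' i = 0 := fun i hi => by
    have h1 : i ∉ Function.support l := by simpa using hi
    have h2 : i ∉ Function.support l' := hsupp ▸ h1
    simpa using And.intro h1 h2
  rw [← Set.coe_toFinset (Function.support l), linearIndepOn_finset_iff] at hli
  have hzero := hli (l - l') (by
    have : (l - l') ᵥ* W = 0 := by rw [sub_vecMul, hl, hl', sub_self]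
    rw [vecMul_eq_sum] at this
    rw [← this]
    refine Finset.sum_subset (Finset.subset_univ _) fun i _ hi => ?_
    simp [hsub i hi])
  funext i
  by_cases hi : i ∈ (Function.support l).toFinset
  · exact sub_eq_zero.1 (hzero i hi)
  · rw [(hsub i hi).1, (hsub i hi).2]

variable [Fintype n]

/-- Weak duality of linear programming. -/
theorem neg_dotProduct_le_of_dualFeasible {W : Matrix m n ℝ} {b : n → ℝ} {l d : m → ℝ}
    {y : n → ℝ} (hl : 0 ≤ l) (hlW : l ᵥ* W = -b) (hy : W *ᵥ y ≤ d) : -(l ⬝ᵥ d) ≤ b ⬝ᵥ y := by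
  have h1 : l ⬝ᵥ (W *ᵥ y) ≤ l ⬝ᵥ d := dotProduct_le_dotProduct_of_nonneg_left hy hl
  rw [dotProduct_mulVec, hlW, neg_dotProduct] at h1
  linarith

/-- A feasible point of a bounded linear program can be improved to one at which the active
constraints determine the objective. -/
theorem exists_active_determined (W : Matrix m n ℝ) (b : n → ℝ) (d : m → ℝ)
    (hbd : BddBelow ((fun y => b ⬝ᵥ y) '' {y | W *ᵥ y ≤ d})) {y : n → ℝ} (hy : W *ᵥ y ≤ d) :
    ∃ y', W *ᵥ y' ≤ d ∧ b ⬝ᵥ y' ≤ b ⬝ᵥ y ∧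
      ∀ z, (∀ i, (W *ᵥ y') i = d i → (W *ᵥ z) i = 0) → b ⬝ᵥ z = 0 := by
  classical
  let act : (n → ℝ) → Finset m := fun y => Finset.univ.filter fun i => (W *ᵥ y) i = d i
  let F : Set (n → ℝ) := {y' | W *ᵥ y' ≤ d ∧ b ⬝ᵥ y' ≤ b ⬝ᵥ y}
  -- Take a point with the most active constraints. A direction that keeps them active and lowers
  -- the objective would either meet a further constraint, against maximality, or span a feasible
  -- ray, against boundedness.
  obtain ⟨y', hy', hmax⟩ : ∃ y' ∈ F, ∀ y'' ∈ F, (act y'').card ≤ (act y').card := by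
    have hfin : ((fun y => (act y).card) '' F).Finite :=
      (Set.finite_Iic (Fintype.card m)).subset (by
        rintro _ ⟨x, -, rfl⟩
        exact Finset.card_le_univ _)
    obtain ⟨_, ⟨y', hy', rfl⟩, h⟩ := Set.exists_max_image _ id hfin ⟨_, y, ⟨hy, le_rfl⟩, rfl⟩
    exact ⟨y', hy', fun y'' hy'' => h _ ⟨y'', hy'', rfl⟩⟩
  refine ⟨y', hy'.1, hy'.2, ?_⟩
  have key : ∀ z, (∀ i, (W *ᵥ y') i = d i → (W *ᵥ z) i = 0) → 0 ≤ b ⬝ᵥ z := by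
    intro z hz
    by_contra! hneg
    by_cases hrec : ∃ i ∈ Finset.univ, 0 < (W *ᵥ z) i
    · obtain ⟨θ, hθ, ⟨j, -, hjpos, hj⟩, hle⟩ := Finset.univ.exists_ratio_test
        (fun i => d i - (W *ᵥ y') i) (fun i => (W *ᵥ z) i)
        (fun i _ => sub_nonneg.2 (hy'.1 i)) hrec
      have hF : y' + θ • z ∈ F := by
        refine ⟨fun i => ?_, ?_⟩
        · have := hle i (Finset.mem_univ i)
          simp only [mulVec_add, mulVec_smul, Pi.add_apply, Pi.smul_apply, smul_eq_mul]
          linarith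
        · have := mul_nonpos_of_nonneg_of_nonpos hθ hneg.le
          have := hy'.2
          simp only [dotProduct_add, dotProduct_smul, smul_eq_mul]
          linarith
      have hsub : act y' ⊂ act (y' + θ • z) := by
        refine Finset.ssubset_iff_subset_ne.2 ⟨fun i hi => ?_, fun heq => ?_⟩
        · simp only [act, Finset.mem_filter, Finset.mem_univ, true_and] at hi ⊢
          simp [mulVec_add, mulVec_smul, hz i hi, hi]
        · have hjm : j ∈ act (y' + θ • z) := by
            simp only [act, Finset.mem_filter, Finset.mem_univ, true_and, mulVec_add, mulVec_smul,
              Pi.add_apply, Pi.smul_apply, smul_eq_mul]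
            linarith
          rw [← heq] at hjm
          simp only [act, Finset.mem_filter, Finset.mem_univ, true_and] at hjm
          exact hjpos.ne' (hz j hjm)
      exact absurd (hmax _ hF) (not_le.2 (Finset.card_lt_card hsub))
    · push Not at hrec
      obtain ⟨B, hB⟩ := hbd
      obtain ⟨N, hN⟩ := exists_nat_gt ((b ⬝ᵥ y' - B) / -(b ⬝ᵥ z))
      have hfeas : W *ᵥ (y' + (N : ℝ) • z) ≤ d := fun i => by
        have := mul_nonpos_of_nonneg_of_nonpos (Nat.cast_nonneg (α := ℝ) N)
          (hrec i (Finset.mem_univ i))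
        have := hy'.1 i
        simp only [mulVec_add, mulVec_smul, Pi.add_apply, Pi.smul_apply, smul_eq_mul]
        linarith
      have hle := hB ⟨_, hfeas, rfl⟩
      simp only [dotProduct_add, dotProduct_smul, smul_eq_mul] at hle
      rw [div_lt_iff₀ (by linarith)] at hN
      linarith
  intro z hz
  refine le_antisymm ?_ (key z hz)
  have := key (-z) fun i hi => by simp [mulVec_neg, hz i hi]
  simpa using this

/-- A feasible linear program that is bounded below has an optimal solution. -/
theorem exists_isMinOn_dotProduct (W : Matrix m n ℝ) (b : n → ℝ) (d : m → ℝ)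
    (hne : ∃ y, W *ᵥ y ≤ d) (hbd : BddBelow ((fun y => b ⬝ᵥ y) '' {y | W *ᵥ y ≤ d})) :
    ∃ y, W *ᵥ y ≤ d ∧ ∀ y', W *ᵥ y' ≤ d → b ⬝ᵥ y ≤ b ⬝ᵥ y' := by
  classical
  -- On `G` the objective depends only on the set of active constraints, so it takes finitely many
  -- values there.
  let G : Set (n → ℝ) := {y | W *ᵥ y ≤ d ∧
    ∀ z, (∀ i, (W *ᵥ y) i = d i → (W *ᵥ z) i = 0) → b ⬝ᵥ z = 0}
  have huniq : ∀ y ∈ G, ∀ y' ∈ G, (∀ i, (W *ᵥ y) i = d i ↔ (W *ᵥ y') i = d i) →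
      b ⬝ᵥ y = b ⬝ᵥ y' := fun y hy y' _ h => by
    have := hy.2 (y - y') fun i hi => by simp [mulVec_sub, hi, (h i).1 hi]
    rwa [dotProduct_sub, sub_eq_zero] at this
  have hfin : ((fun y => b ⬝ᵥ y) '' G).Finite := by
    let f : Set m → ℝ := fun I =>
      if h : ∃ y ∈ G, {i | (W *ᵥ y) i = d i} = I then b ⬝ᵥ h.choose else 0
    refine (Set.finite_range f).subset ?_
    rintro _ ⟨y, hy, rfl⟩
    have h : ∃ y' ∈ G, {i | (W *ᵥ y') i = d i} = {i | (W *ᵥ y) i = d i} := ⟨y, hy, rfl⟩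
    refine ⟨{i | (W *ᵥ y) i = d i}, ?_⟩
    simp only [f, dif_pos h]
    exact huniq _ h.choose_spec.1 _ hy fun i => Set.ext_iff.1 h.choose_spec.2 i
  obtain ⟨y₀, hy₀⟩ := hne
  obtain ⟨y₁, h₁, -, h₁'⟩ := exists_active_determined W b d hbd hy₀
  obtain ⟨_, ⟨y, hy, rfl⟩, hmin⟩ := Set.exists_min_image _ id hfin ⟨_, y₁, ⟨h₁, h₁'⟩, rfl⟩
  refine ⟨y, hy.1, fun y' hy' => ?_⟩
  obtain ⟨y'', h, hle, h'⟩ := exists_active_determined W b d hbd hy'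
  exact (hmin _ ⟨y'', ⟨h, h'⟩, rfl⟩).trans hle

/-- Strong duality of linear programming, with a dual vertex: a feasible linear program that is
bounded below has an optimal solution whose value is attained at a dual vertex. -/
theorem exists_optimal_dualVertex (W : Matrix m n ℝ) (b : n → ℝ) (d : m → ℝ)
    (hne : ∃ y, W *ᵥ y ≤ d) (hbd : BddBelow ((fun y => b ⬝ᵥ y) '' {y | W *ᵥ y ≤ d})) :
    ∃ y, W *ᵥ y ≤ d ∧ ∃ l ∈ dualVertices W b, b ⬝ᵥ y = -(l ⬝ᵥ d) := by
  classical
  obtain ⟨y, hy, hmin⟩ := exists_isMinOn_dotProduct W b d hne hbd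
  refine ⟨y, hy, ?_⟩
  let act : Finset m := Finset.univ.filter fun i => (W *ᵥ y) i = d i
  -- If `z` has nonnegative product with all active rows, `y - t • z` is feasible for small `t > 0`;
  -- optimality then gives `b ⬝ᵥ z ≤ 0`, and Farkas applies.
  have hcone : -b ∈ conicSpan (fun i => W i) act := by
    refine mem_conicSpan_of_forall_dotProduct _ _ _ fun z hz => ?_
    have hsmall : ∀ i, ∀ᶠ t : ℝ in nhdsWithin 0 (Set.Ioi 0),
        (W *ᵥ y) i - t * (W *ᵥ z) i ≤ d i := fun i => by
      rcases (hy i).lt_or_eq with h | h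
      · have hc : Continuous fun t : ℝ => (W *ᵥ y) i - t * (W *ᵥ z) i := by fun_prop
        have := (hc.tendsto 0).eventually_lt_const (u := d i) (by simpa using h)
        filter_upwards [nhdsWithin_le_nhds this] with t ht using ht.le
      · filter_upwards [self_mem_nhdsWithin] with t ht
        have h1 : 0 ≤ (W *ᵥ z) i := hz i (by simp [act, h])
        have h2 := mul_nonneg (le_of_lt (Set.mem_Ioi.1 ht)) h1
        linarith
    obtain ⟨t, ht, htpos⟩ := ((Filter.eventually_all.2 hsmall).and
      (self_mem_nhdsWithin (s := Set.Ioi (0 : ℝ)))).exists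
    have := hmin (y - t • z) fun i => by
      simpa [mulVec_sub, mulVec_smul] using ht i
    simp only [dotProduct_sub, dotProduct_smul, smul_eq_mul] at this
    have h3 : t * (b ⬝ᵥ z) ≤ 0 := by linarith
    rw [neg_dotProduct]
    have := nonpos_of_mul_nonpos_right h3 (Set.mem_Ioi.1 htpos)
    linarith
  obtain ⟨c, hc, hsum⟩ := hcone
  obtain ⟨t, hts, hti, c', hc', hsum'⟩ := exists_linearIndepOn_nonneg_sum_eq (fun i => W i) act c hc
  let l : m → ℝ := fun i => if i ∈ t then c' i else 0
  have hlW : l ᵥ* W = -b := by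
    rw [vecMul_eq_sum, ← hsum, ← hsum']
    simp only [l, ite_smul, zero_smul, Finset.sum_ite_mem, Finset.univ_inter]
  refine ⟨l, ⟨fun i => ?_, hlW, hti.mono fun i hi => ?_⟩, ?_⟩
  · by_cases hi : i ∈ t <;> simp [l, hi]
    exact hc' i hi
  · by_contra h
    exact hi (by simpa [l] using fun h' : i ∈ t => absurd h' h)
  -- Complementary slackness: `l` is supported on active rows.
  · have hcs : l ⬝ᵥ (W *ᵥ y) = l ⬝ᵥ d := Finset.sum_congr rfl fun i _ => by
      by_cases hi : i ∈ t
      · have := hts hi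
        simp only [act, Finset.mem_filter, Finset.mem_univ, true_and] at this
        rw [this]
      · simp [l, hi]
    rw [← hcs, dotProduct_mulVec, hlW, neg_dotProduct, neg_neg]

end Matrix

/-! ### The exponential perspective and Gibbs distributions -/

theorem EReal.coe_finset_sum {ι : Type*} (s : Finset ι) (f : ι → ℝ) :
    ((∑ i ∈ s, f i : ℝ) : EReal) = ∑ i ∈ s, (f i : EReal) := by
  classical
  induction s using Finset.induction_on with
  | empty => simp
  | insert a s ha ih => rw [Finset.sum_insert ha, Finset.sum_insert ha, EReal.coe_add, ih]

theorem expPersp_nonneg (ν t : ℝ) : 0 ≤ expPersp ν t := by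
  unfold expPersp
  split_ifs with h1 h2
  · exact EReal.coe_nonneg.2 (by positivity)
  · exact le_rfl
  · exact le_top

theorem expPersp_mono (ν : ℝ) : Monotone (expPersp ν) := by
  intro t t' h
  unfold expPersp
  split_ifs with h1 h2 h3 h4
  · exact EReal.coe_le_coe_iff.2 (by gcongr)
  · exact le_rfl
  · exact le_top
  · exact absurd (h.trans h4) h2
  · exact le_rfl

/-- Young's inequality between the exponential perspective and the entropy. -/
theorem coe_le_expPersp {ν : ℝ} (hν : 0 ≤ ν) (t : ℝ) {q : ℝ} (hq : 0 ≤ q) :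
    ((q * t - ν * (q * Real.log q) : ℝ) : EReal) ≤ expPersp ν t := by
  unfold expPersp
  split_ifs with h1 h2
  · refine EReal.coe_le_coe_iff.2 ?_
    rcases hq.eq_or_lt with rfl | hq
    · simp; positivity
    -- The inequality `u + 1 ≤ exp u` at `u = t / ν - 1 - log q`, to be multiplied by `ν * q`.
    have h := Real.add_one_le_exp (t / ν - 1 - Real.log q)
    have he : Real.exp (t / ν - 1) = q * Real.exp (t / ν - 1 - Real.log q) := by
      rw [Real.exp_sub _ (Real.log q), Real.exp_log hq]; field_simp
    rw [he]
    have h' := mul_le_mul_of_nonneg_left h (mul_pos h1 hq).le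
    have ht : ν * (t / ν) = t := by field_simp
    calc q * t - ν * (q * Real.log q) = ν * q * (t / ν - 1 - Real.log q + 1) := by
          linear_combination -q * ht
      _ ≤ _ := h'
      _ = _ := by ring
  · obtain rfl : ν = 0 := le_antisymm (not_lt.1 h1) hν
    have := mul_nonpos_of_nonneg_of_nonpos hq h2
    exact_mod_cast (by simpa using this : q * t - 0 * (q * Real.log q) ≤ 0)
  · exact le_top

/-- The sum defining the Gibbs distribution with inverse temperature `t`. -/
def gibbsSum {K : ℕ} (r s : Fin K → ℝ) (t : ℝ) : ℝ := ∑ k, r k * Real.exp (s k * t)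

/-- The Gibbs distribution with inverse temperature `t`. -/
def gibbs {K : ℕ} (r s : Fin K → ℝ) (t : ℝ) (k : Fin K) : ℝ :=
  r k * Real.exp (s k * t) / gibbsSum r s t

/-- The expectation under the Gibbs distribution. -/
def gibbsMean {K : ℕ} (r s : Fin K → ℝ) (t : ℝ) : ℝ := ∑ k, gibbs r s t k * s k

/-- The divergence of the Gibbs distribution from the reference distribution. -/
def gibbsEntropy {K : ℕ} (r s : Fin K → ℝ) (t : ℝ) : ℝ :=
  t * gibbsMean r s t - Real.log (gibbsSum r s t)

theorem gibbsSum_zero {K : ℕ} {r : Fin K → ℝ} (hsum : ∑ k, r k = 1) (s : Fin K → ℝ) :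
    gibbsSum r s 0 = 1 := by simp [gibbsSum, hsum]

theorem gibbsMean_zero {K : ℕ} {r : Fin K → ℝ} (hsum : ∑ k, r k = 1) (s : Fin K → ℝ) :
    gibbsMean r s 0 = ∑ k, r k * s k := by
  simp [gibbsMean, gibbs, gibbsSum_zero hsum]

theorem gibbsEntropy_zero {K : ℕ} {r : Fin K → ℝ} (hsum : ∑ k, r k = 1) (s : Fin K → ℝ) :
    gibbsEntropy r s 0 = 0 := by
  simp [gibbsEntropy, gibbsSum_zero hsum]

section Gibbs

variable {K : ℕ} {r : Fin K → ℝ} (hr : ∀ k, 0 ≤ r k) (hsum : ∑ k, r k = 1) (s : Fin K → ℝ)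

include hr hsum

theorem gibbsSum_pos (t : ℝ) : 0 < gibbsSum r s t := by
  obtain ⟨k, -, hk⟩ : ∃ k ∈ Finset.univ, 0 < r k := by
    by_contra! h
    have := Finset.sum_nonpos h
    linarith
  exact Finset.sum_pos' (fun k _ => mul_nonneg (hr k) (Real.exp_pos _).le)
    ⟨k, Finset.mem_univ k, mul_pos hk (Real.exp_pos _)⟩

theorem gibbs_nonneg (t : ℝ) (k : Fin K) : 0 ≤ gibbs r s t k :=
  div_nonneg (mul_nonneg (hr k) (Real.exp_pos _).le) (gibbsSum_pos hr hsum s t).le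

theorem sum_gibbs (t : ℝ) : ∑ k, gibbs r s t k = 1 := by
  unfold gibbs
  rw [← Finset.sum_div]
  exact div_self (gibbsSum_pos hr hsum s t).ne'

theorem log_gibbs_div (t : ℝ) {k : Fin K} (hk : r k ≠ 0) :
    Real.log (gibbs r s t k / r k) = s k * t - Real.log (gibbsSum r s t) := by
  have hZ := gibbsSum_pos hr hsum s t
  have : gibbs r s t k / r k = Real.exp (s k * t) / gibbsSum r s t := by
    unfold gibbs; field_simp
  rw [this, Real.log_div (Real.exp_pos _).ne' hZ.ne', Real.log_exp]

theorem sum_gibbs_mul_log (t : ℝ) :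
    ∑ k, gibbs r s t k * Real.log (gibbs r s t k / r k) = gibbsEntropy r s t := by
  have h : ∀ k, gibbs r s t k * Real.log (gibbs r s t k / r k) =
      t * (gibbs r s t k * s k) - gibbs r s t k * Real.log (gibbsSum r s t) := fun k => by
    by_cases hk : r k = 0
    · simp [gibbs, hk]
    · rw [log_gibbs_div hr hsum s t hk]; ring
  simp_rw [h]
  rw [Finset.sum_sub_distrib, ← Finset.mul_sum, ← Finset.sum_mul, sum_gibbs hr hsum, one_mul]
  rfl

/-- Termwise `g * log (g / r) ≥ g - r`, and the right-hand sides sum to zero. -/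
theorem gibbsEntropy_nonneg (t : ℝ) : 0 ≤ gibbsEntropy r s t := by
  rw [← sum_gibbs_mul_log hr hsum s t]
  have h : ∀ k, gibbs r s t k - r k ≤ gibbs r s t k * Real.log (gibbs r s t k / r k) := fun k => by
    by_cases hk : r k = 0
    · simp [gibbs, hk]
    have hk' : 0 < r k := lt_of_le_of_ne (hr k) (Ne.symm hk)
    have hg : 0 < gibbs r s t k :=
      div_pos (mul_pos hk' (Real.exp_pos _)) (gibbsSum_pos hr hsum s t)
    have := mul_le_mul_of_nonneg_left (Real.one_sub_inv_le_log_of_pos (div_pos hg hk')) hg.le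
    refine le_trans (le_of_eq ?_) this
    field_simp
  calc (0 : ℝ) = ∑ k, (gibbs r s t k - r k) := by
        rw [Finset.sum_sub_distrib, sum_gibbs hr hsum, hsum, sub_self]
    _ ≤ _ := Finset.sum_le_sum fun k _ => h k

theorem continuous_gibbsMean : Continuous (gibbsMean r s) := by
  unfold gibbsMean gibbs
  have h : Continuous (gibbsSum r s) := by unfold gibbsSum; fun_prop
  exact continuous_finsetSum _ fun k _ =>
    ((by fun_prop : Continuous fun t => r k * Real.exp (s k * t)).div h
      fun t => (gibbsSum_pos hr hsum s t).ne').mul continuous_const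

theorem continuous_gibbsEntropy : Continuous (gibbsEntropy r s) := by
  have h : Continuous (gibbsSum r s) := by unfold gibbsSum; fun_prop
  exact (continuous_id.mul (continuous_gibbsMean hr hsum s)).sub
    (h.log fun t => (gibbsSum_pos hr hsum s t).ne')

end Gibbs

/-! ### Duality for the worst expectation over the ambiguity set -/

namespace TwoStageDRO

variable (D : TwoStageDRO)

theorem mem_ambiguity_iff {p : Fin D.K → ℝ} : p ∈ D.ambiguity ↔
    (∀ k, 0 ≤ p k) ∧ ∑ k, p k = 1 ∧ (∀ k, D.pbar k = 0 → p k = 0) ∧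
      ∑ k, p k * Real.log (p k / D.pbar k) ≤ D.rho := by
  simp only [ambiguity, klVec, Set.mem_ofPred_eq]
  split_ifs with h
  · rw [EReal.coe_le_coe_iff]; tauto
  · simp [h]

theorem dualCost_mono {s s' : Fin D.K → ℝ} (hp : ∀ k, 0 ≤ D.pbar k) (h : s ≤ s') (μ ν : ℝ) :
    D.dualCost s μ ν ≤ D.dualCost s' μ ν := by
  unfold dualCost
  refine add_le_add le_rfl (Finset.sum_le_sum fun k _ => ?_)
  exact mul_le_mul_of_nonneg_left (expPersp_mono ν (sub_le_sub_right (h k) μ))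
    (EReal.coe_nonneg.2 (hp k))

theorem dualCost_ne_bot (hp : ∀ k, 0 ≤ D.pbar k) (s : Fin D.K → ℝ) (μ ν : ℝ) :
    D.dualCost s μ ν ≠ ⊥ := by
  unfold dualCost
  refine EReal.add_ne_bot_iff.2 ⟨EReal.coe_ne_bot _, ?_⟩
  refine ne_bot_of_le_ne_bot (EReal.coe_ne_bot 0) (b := ((0 : ℝ) : EReal)) ?_
  exact Finset.sum_nonneg fun k _ => EReal.mul_nonneg (EReal.coe_nonneg.2 (hp k))
    (expPersp_nonneg _ _)

theorem dualCost_of_pos (s : Fin D.K → ℝ) (μ : ℝ) {ν : ℝ} (hν : 0 < ν) :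
    D.dualCost s μ ν =
      ((μ + D.rho * ν + ∑ k, D.pbar k * (ν * Real.exp ((s k - μ) / ν - 1)) : ℝ) : EReal) := by
  simp only [dualCost, expPersp, if_pos hν, EReal.coe_add, EReal.coe_finset_sum, EReal.coe_mul]

/-- The dual expression as a supremum of affine functions of `s`, `μ` and `ν`. -/
theorem dualCost_le_coe_iff (hp : ∀ k, 0 ≤ D.pbar k) (s : Fin D.K → ℝ) (μ : ℝ) {ν : ℝ}
    (hν : 0 ≤ ν) (η : ℝ) : D.dualCost s μ ν ≤ (η : EReal) ↔
    ∀ q : Fin D.K → ℝ, (∀ k, 0 ≤ q k) → μ + D.rho * ν +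
      ∑ k, D.pbar k * (q k * (s k - μ) - ν * (q k * Real.log (q k))) ≤ η := by
  constructor
  · intro h q hq
    rw [← EReal.coe_le_coe_iff]
    refine le_trans ?_ h
    rw [EReal.coe_add, EReal.coe_finset_sum]
    refine add_le_add le_rfl (Finset.sum_le_sum fun k _ => ?_)
    rw [EReal.coe_mul]
    exact mul_le_mul_of_nonneg_left (coe_le_expPersp hν _ (hq k)) (EReal.coe_nonneg.2 (hp k))
  · intro h
    rcases hν.lt_or_eq with hν | rfl
    · rw [D.dualCost_of_pos s μ hν, EReal.coe_le_coe_iff]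
      -- The equality case of Young's inequality.
      refine le_trans (le_of_eq ?_) (h (fun k => Real.exp ((s k - μ) / ν - 1))
        fun k => (Real.exp_pos _).le)
      congr 1
      refine Finset.sum_congr rfl fun k _ => ?_
      rw [Real.log_exp]
      field_simp
      ring
    -- At `ν = 0` no entropy term remains, so large multiples of a unit vector force `s k ≤ μ`
    -- wherever `pbar k > 0`.
    · have hs : ∀ k, 0 < D.pbar k → s k - μ ≤ 0 := by
        intro k hk
        by_contra! hpos
        obtain ⟨N, hN⟩ := exists_nat_gt ((η - μ) / (D.pbar k * (s k - μ)))
        rw [div_lt_iff₀ (mul_pos hk hpos)] at hN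
        have := h (Pi.single k (N : ℝ)) fun j => by
          by_cases hj : j = k
          · subst hj; simp
          · simp [hj]
        simp only [mul_zero, zero_mul, sub_zero, add_zero] at this
        rw [Finset.sum_eq_single k (fun j _ hj => by simp [hj]) (by simp)] at this
        simp only [Pi.single_eq_same] at this
        nlinarith
      have hz : ∀ k, (D.pbar k : EReal) * expPersp 0 (s k - μ) = 0 := fun k => by
        rcases (hp k).lt_or_eq with hk | hk
        · simp [expPersp, hs k hk]
        · simp [← hk]
      have h0 := h 0 fun _ => le_rfl
      simp only [dualCost, hz, Finset.sum_const_zero, add_zero, EReal.coe_le_coe_iff]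
      simpa using h0

theorem pbar_mem_ambiguity (hp : ∀ k, 0 ≤ D.pbar k) (hsum : ∑ k, D.pbar k = 1)
    (hrho : 0 ≤ D.rho) : D.pbar ∈ D.ambiguity := by
  refine D.mem_ambiguity_iff.2 ⟨hp, hsum, fun _ h => h, ?_⟩
  refine le_trans (le_of_eq (Finset.sum_eq_zero fun k _ => ?_)) hrho
  by_cases hk : D.pbar k = 0 <;> simp [hk]

/-- Weak duality for the worst-case expectation. -/
theorem sum_le_of_dualCost_le (hp : ∀ k, 0 ≤ D.pbar k) {p s : Fin D.K → ℝ}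
    (hpa : p ∈ D.ambiguity) {μ ν η : ℝ} (hν : 0 ≤ ν)
    (h : D.dualCost s μ ν ≤ (η : EReal)) : ∑ k, p k * s k ≤ η := by
  obtain ⟨h0, h1, hac, hkl⟩ := D.mem_ambiguity_iff.1 hpa
  -- The test vector is the density of `p` with respect to `pbar`.
  have := (D.dualCost_le_coe_iff hp s μ hν η).1 h (fun k => p k / D.pbar k)
    fun k => div_nonneg (h0 k) (hp k)
  have hterm : ∀ k, D.pbar k * (p k / D.pbar k * (s k - μ) -
      ν * (p k / D.pbar k * Real.log (p k / D.pbar k))) =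
      p k * s k - p k * μ - ν * (p k * Real.log (p k / D.pbar k)) := fun k => by
    by_cases hk : D.pbar k = 0
    · simp [hk, hac k hk]
    · field_simp
  simp_rw [hterm] at this
  rw [Finset.sum_sub_distrib, Finset.sum_sub_distrib, ← Finset.sum_mul, ← Finset.mul_sum, h1]
    at this
  have := mul_le_mul_of_nonneg_left hkl hν
  linarith

theorem gibbs_mem_ambiguity (hp : ∀ k, 0 ≤ D.pbar k) (hsum : ∑ k, D.pbar k = 1)
    {s : Fin D.K → ℝ} {t : ℝ} (h : gibbsEntropy D.pbar s t ≤ D.rho) :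
    gibbs D.pbar s t ∈ D.ambiguity :=
  D.mem_ambiguity_iff.2 ⟨gibbs_nonneg hp hsum s t, sum_gibbs hp hsum s t,
    fun k hk => by simp [gibbs, hk], by rwa [sum_gibbs_mul_log hp hsum]⟩

/-- The value of the dual expression at the Gibbs multiplier. -/
theorem exists_dualCost_eq_gibbs (hp : ∀ k, 0 ≤ D.pbar k) (hsum : ∑ k, D.pbar k = 1)
    (s : Fin D.K → ℝ) {t : ℝ} (ht : 0 < t) : ∃ μ ν : ℝ, 0 ≤ ν ∧ D.dualCost s μ ν =
      ((gibbsMean D.pbar s t + (D.rho - gibbsEntropy D.pbar s t) / t : ℝ) : EReal) := by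
  have hZ := gibbsSum_pos hp hsum s t
  -- With `ν = 1 / t`, this `μ` makes the terms `pbar k * exp ((s k - μ) / ν - 1)` the Gibbs
  -- probabilities.
  refine ⟨(Real.log (gibbsSum D.pbar s t) - 1) / t, 1 / t, by positivity, ?_⟩
  rw [D.dualCost_of_pos _ _ (by positivity)]
  congr 1
  have hterm : ∀ k, D.pbar k * (1 / t * Real.exp ((s k - (Real.log (gibbsSum D.pbar s t) - 1) / t) /
      (1 / t) - 1)) = gibbs D.pbar s t k / t := fun k => by
    have : (s k - (Real.log (gibbsSum D.pbar s t) - 1) / t) / (1 / t) - 1 =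
        s k * t - Real.log (gibbsSum D.pbar s t) := by field_simp; ring
    rw [this, Real.exp_sub, Real.exp_log hZ, gibbs]
    field_simp
  simp_rw [hterm]
  rw [← Finset.sum_div, sum_gibbs hp hsum, gibbsEntropy]
  field_simp
  ring

/-- Strong duality for the worst-case expectation. -/
theorem exists_dualCost_le_add (hp : ∀ k, 0 ≤ D.pbar k) (hsum : ∑ k, D.pbar k = 1)
    (hrho : 0 ≤ D.rho) {s : Fin D.K → ℝ} {η δ : ℝ} (hδ : 0 < δ)
    (h : ∀ p ∈ D.ambiguity, ∑ k, p k * s k ≤ η) :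
    ∃ μ ν : ℝ, 0 ≤ ν ∧ D.dualCost s μ ν ≤ ((η + δ : ℝ) : EReal) := by
  suffices ∃ t, 0 < t ∧
      gibbsMean D.pbar s t + (D.rho - gibbsEntropy D.pbar s t) / t ≤ η + δ by
    obtain ⟨t, ht, hle⟩ := this
    obtain ⟨μ, ν, hν, heq⟩ := D.exists_dualCost_eq_gibbs hp hsum s ht
    exact ⟨μ, ν, hν, heq ▸ EReal.coe_le_coe_iff.2 hle⟩
  rcases hrho.lt_or_eq with hpos | hzero
  -- If the entropy reaches `rho`, then at a `t` where they are equal the duality gap vanishes.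
  -- Otherwise every Gibbs distribution with `t ≥ 0` is admissible, and `t = rho / δ` leaves a gap
  -- of at most `δ`.
  · by_cases hex : ∃ t, 0 ≤ t ∧ D.rho ≤ gibbsEntropy D.pbar s t
    · obtain ⟨t, ht, hle⟩ := hex
      obtain ⟨t', ht', heq⟩ := intermediate_value_Icc ht
        (continuous_gibbsEntropy hp hsum s).continuousOn
        (show D.rho ∈ Set.Icc _ _ from ⟨by rw [gibbsEntropy_zero hsum]; exact hrho, hle⟩)
      have hmem := h _ (D.gibbs_mem_ambiguity hp hsum heq.le)
      refine ⟨t', lt_of_le_of_ne ht'.1 ?_, ?_⟩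
      · rintro rfl
        rw [gibbsEntropy_zero hsum] at heq
        exact hpos.ne heq
      · rw [heq, sub_self, zero_div]
        change gibbsMean D.pbar s t' ≤ η at hmem
        linarith
    · push Not at hex
      have ht : 0 < D.rho / δ := by positivity
      have hmem := h _ (D.gibbs_mem_ambiguity hp hsum (hex _ ht.le).le)
      change gibbsMean D.pbar s (D.rho / δ) ≤ η at hmem
      refine ⟨D.rho / δ, ht, add_le_add hmem ?_⟩
      rw [div_le_iff₀ ht, mul_div_cancel₀ _ hδ.ne']
      have := gibbsEntropy_nonneg hp hsum s (D.rho / δ)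
      linarith
  -- For `rho = 0` the gap is nonpositive, and as `t` tends to zero the Gibbs mean tends to the mean
  -- under `pbar`.
  · have hlim := ((continuous_gibbsMean hp hsum s).tendsto 0).eventually_lt_const (u := η + δ) (by
      have := h _ (D.pbar_mem_ambiguity hp hsum hrho)
      rw [gibbsMean_zero hsum]
      linarith)
    obtain ⟨t, ht, htpos⟩ := ((hlim.filter_mono nhdsWithin_le_nhds).and
      (self_mem_nhdsWithin (s := Set.Ioi (0 : ℝ)))).exists
    refine ⟨t, htpos, ?_⟩
    have := gibbsEntropy_nonneg hp hsum s t
    have : (D.rho - gibbsEntropy D.pbar s t) / t ≤ 0 :=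
      div_nonpos_of_nonpos_of_nonneg (by linarith) htpos.le
    linarith

theorem iSup_ambiguity_le_coe_iff (s : Fin D.K → ℝ) (η : ℝ) :
    ⨆ p ∈ D.ambiguity, ∑ k, (p k : EReal) * (s k : EReal) ≤ (η : EReal) ↔
      ∀ p ∈ D.ambiguity, ∑ k, p k * s k ≤ η := by
  simp only [iSup_le_iff, ← EReal.coe_mul, ← EReal.coe_finset_sum, EReal.coe_le_coe_iff]

theorem iSup_ambiguity_eq_iInf_dualCost (hp : ∀ k, 0 ≤ D.pbar k) (hsum : ∑ k, D.pbar k = 1)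
    (hrho : 0 ≤ D.rho) (s : Fin D.K → ℝ) :
    ⨆ p ∈ D.ambiguity, ∑ k, (p k : EReal) * (s k : EReal) =
      ⨅ (μ : ℝ) (ν : ℝ) (_ : 0 ≤ ν), D.dualCost s μ ν := by
  refine le_antisymm (le_iInf fun μ => le_iInf fun ν => le_iInf fun hν => ?_) ?_
  · refine EReal.le_of_forall_lt_iff_le.1 fun z hz => (D.iSup_ambiguity_le_coe_iff s z).2 ?_
    exact fun p hpa => D.sum_le_of_dualCost_le hp hpa hν hz.le
  · refine EReal.le_of_forall_lt_iff_le.1 fun z hz => ?_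
    refine EReal.le_of_forall_lt_iff_le.1 fun w hw => ?_
    rw [EReal.coe_lt_coe_iff] at hw
    obtain ⟨μ, ν, hν, h⟩ := D.exists_dualCost_le_add hp hsum hrho (sub_pos.2 hw)
      ((D.iSup_ambiguity_le_coe_iff s z).1 hz.le)
    rw [add_sub_cancel] at h
    exact (iInf_le_of_le μ (iInf_le_of_le ν (iInf_le _ hν))).trans h

end TwoStageDRO

/-! ### Compactness and attainment for a positive radius -/

namespace TwoStageDRO

variable (D : TwoStageDRO)

/-- For a positive radius, `μ` and `ν` are bounded on the sublevel sets of the dual expression. -/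
theorem bounds_of_dualCost_le (hp : ∀ k, 0 ≤ D.pbar k) (hsum : ∑ k, D.pbar k = 1)
    (hrho : 0 < D.rho) {s : Fin D.K → ℝ} {B μ ν η : ℝ} (hν : 0 ≤ ν) (hs : ∀ k, B ≤ s k)
    (h : D.dualCost s μ ν ≤ (η : EReal)) :
    B ≤ η ∧ ν ≤ (η - B) / D.rho ∧ μ ≤ η ∧
      2 * B - η - 2 * Real.log 2 * ((η - B) / D.rho) ≤ μ := by
  have hq := (D.dualCost_le_coe_iff hp s μ hν η).1 h
  have hρν := mul_nonneg hrho.le hν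
  have hB : B ≤ ∑ k, D.pbar k * s k := by
    calc B = ∑ k, D.pbar k * B := by rw [← Finset.sum_mul, hsum, one_mul]
      _ ≤ _ := Finset.sum_le_sum fun k _ => mul_le_mul_of_nonneg_left (hs k) (hp k)
  have hconst : ∀ a : ℝ, ∑ k, D.pbar k * (a * (s k - μ) - ν * (a * Real.log a)) =
      a * (∑ k, D.pbar k * s k) - a * μ - ν * (a * Real.log a) := fun a => by
    have : ∀ k, D.pbar k * (a * (s k - μ) - ν * (a * Real.log a)) =
        a * (D.pbar k * s k) - D.pbar k * (a * μ + ν * (a * Real.log a)) := fun k => by ring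
    simp_rw [this]
    rw [Finset.sum_sub_distrib, ← Finset.mul_sum, ← Finset.sum_mul, hsum]
    ring
  -- The constant `0` bounds `μ` from above, the constant `1` cancels `μ` and bounds `ν`, and the
  -- constant `2` changes the sign of `μ` and bounds it from below.
  have h0 := hq (fun _ => 0) fun _ => le_rfl
  have h1 := hq (fun _ => 1) fun _ => zero_le_one
  have h2 := hq (fun _ => 2) fun _ => zero_le_two
  rw [hconst] at h0 h1 h2
  simp only [Real.log_one] at h1
  have hν' : ν ≤ (η - B) / D.rho := by
    rw [le_div_iff₀ hrho]
    linarith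
  have hlog := mul_le_mul_of_nonneg_left hν' (mul_nonneg zero_le_two (Real.log_nonneg one_le_two))
  exact ⟨by linarith, hν', by linarith, by linarith⟩

/-- For a positive radius, the minimum of `f x + η` over a compact set of `x` subject to dual
constraints with continuous costs is attained. -/
theorem exists_min_of_dualCost_le (hp : ∀ k, 0 ≤ D.pbar k) (hsum : ∑ k, D.pbar k = 1)
    (hrho : 0 < D.rho) {X ι : Type*} [TopologicalSpace X] [T2Space X] [Finite ι] [Nonempty ι]
    {S : Set X} (hS : IsCompact S) (hne : S.Nonempty) {f : X → ℝ} (hf : Continuous f)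
    {s : ι → X → Fin D.K → ℝ} (hs : ∀ i, Continuous (s i)) :
    ∃ x ∈ S, ∃ η μ ν : ℝ, 0 ≤ ν ∧ (∀ i, D.dualCost (s i x) μ ν ≤ (η : EReal)) ∧
      ∀ x' ∈ S, ∀ η' μ' ν' : ℝ, 0 ≤ ν' → (∀ i, D.dualCost (s i x') μ' ν' ≤ (η' : EReal)) →
        f x + η ≤ f x' + η' := by
  obtain ⟨x₀, hx₀⟩ := hne
  obtain ⟨η₀, hη₀⟩ : ∃ η : ℝ, ∀ i, D.dualCost (s i x₀) 0 1 ≤ (η : EReal) := by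
    simp only [D.dualCost_of_pos _ _ one_pos, EReal.coe_le_coe_iff]
    obtain ⟨η, hη⟩ := (Set.finite_range fun i => 0 + D.rho * 1 +
      ∑ k, D.pbar k * (1 * Real.exp ((s i x₀ k - 0) / 1 - 1))).bddAbove
    exact ⟨η, fun i => hη ⟨i, rfl⟩⟩
  obtain ⟨xm, -, hxm⟩ := hS.exists_isMinOn ⟨x₀, hx₀⟩ hf.continuousOn
  obtain ⟨B, hB⟩ : ∃ B : ℝ, ∀ x ∈ S, ∀ i k, B ≤ s i x k := by
    have hb : ∀ ik : ι × Fin D.K, ∃ B : ℝ, ∀ x ∈ S, B ≤ s ik.1 x ik.2 := fun ik => by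
      obtain ⟨y, -, hy⟩ := hS.exists_isMinOn ⟨x₀, hx₀⟩
        ((continuous_apply ik.2).comp (hs ik.1)).continuousOn
      exact ⟨_, fun x hx => hy hx⟩
    choose b hb using hb
    obtain ⟨B, hB⟩ := (Set.finite_range b).bddBelow
    exact ⟨B, fun x hx i k => (hB ⟨(i, k), rfl⟩).trans (hb (i, k) x hx)⟩
  -- A point with `η > C` has a larger objective than the reference point `(x₀, η₀)`, so only `η ≤
  -- C` matters.
  set C : ℝ := f x₀ + η₀ - f xm
  have hηC : η₀ ≤ C := by
    have := hxm hx₀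
    simp only [C]
    linarith [show f xm ≤ f x₀ from this]
  let Z : Set (X × ℝ × ℝ × ℝ) := {z | z.1 ∈ S ∧ 0 ≤ z.2.2.1 ∧ z.2.2.2 ≤ C ∧
    ∀ i, D.dualCost (s i z.1) z.2.1 z.2.2.1 ≤ (z.2.2.2 : EReal)}
  have hZ : IsCompact Z := by
    let R : ℝ := (C - B) / D.rho
    have hR : ∀ η ≤ C, (η - B) / D.rho ≤ R := fun η hη =>
      div_le_div_of_nonneg_right (by linarith) hrho.le
    refine IsCompact.of_isClosed_subset (hS.prod ((isCompact_Icc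
      (a := 2 * B - C - 2 * Real.log 2 * R) (b := C)).prod
      ((isCompact_Icc (a := 0) (b := R)).prod (isCompact_Icc (a := B) (b := C))))) ?_ ?_
    -- The dual expression jumps to `⊤` at `ν = 0`; its affine minorants turn each constraint into
    -- an intersection of closed conditions.
    · have hset : Z = {z | z.1 ∈ S} ∩ {z | 0 ≤ z.2.2.1} ∩ {z | z.2.2.2 ≤ C} ∩
          ⋂ (i : ι) (q : Fin D.K → ℝ) (_ : ∀ k, 0 ≤ q k), {z | z.2.1 + D.rho * z.2.2.1 +
            ∑ k, D.pbar k * (q k * (s i z.1 k - z.2.1) - z.2.2.1 * (q k * Real.log (q k))) ≤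
              z.2.2.2} := by
        ext z
        simp only [Z, Set.mem_inter_iff, Set.mem_ofPred_eq, Set.mem_iInter, and_assoc]
        refine and_congr_right fun _ => and_congr_right fun h => and_congr_right fun _ => ?_
        exact forall_congr' fun i => D.dualCost_le_coe_iff hp _ _ h _
      have hsk : ∀ i k, Continuous fun z : X × ℝ × ℝ × ℝ => s i z.1 k := fun i k =>
        (continuous_apply k).comp ((hs i).comp continuous_fst)
      rw [hset]
      refine (((hS.isClosed.preimage continuous_fst).inter (isClosed_le continuous_const
        (by fun_prop))).inter (isClosed_le (by fun_prop) continuous_const)).inter ?_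
      refine isClosed_iInter fun i => isClosed_iInter fun q => isClosed_iInter fun _ =>
        isClosed_le ?_ (by fun_prop)
      fun_prop
    · rintro ⟨x, μ, ν, η⟩ ⟨hx, hν, hη, h⟩
      dsimp only at hx hν hη h
      obtain ⟨h1, h2, h3, h4⟩ := D.bounds_of_dualCost_le hp hsum hrho hν
        (fun k => hB x hx (Classical.arbitrary ι) k) (h _)
      have hlog := mul_le_mul_of_nonneg_left (hR η hη)
        (mul_nonneg zero_le_two (Real.log_nonneg one_le_two))
      exact ⟨hx, ⟨by linarith, by linarith⟩, ⟨hν, h2.trans (hR η hη)⟩, ⟨h1, hη⟩⟩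
  obtain ⟨⟨x, μ, ν, η⟩, ⟨hx, hν, hη, h⟩, hmin⟩ := hZ.exists_isMinOn
    ⟨(x₀, 0, 1, η₀), hx₀, zero_le_one, hηC, hη₀⟩
    (f := fun z => f z.1 + z.2.2.2) (by fun_prop)
  refine ⟨x, hx, η, μ, ν, hν, h, fun x' hx' η' μ' ν' hν' h' => ?_⟩
  by_cases hC : η' ≤ C
  · exact hmin (show (x', μ', ν', η') ∈ Z from ⟨hx', hν', hC, h'⟩)
  · have h1 : f x + η ≤ f x₀ + η₀ :=
      hmin (show (x₀, 0, 1, η₀) ∈ Z from ⟨hx₀, zero_le_one, hηC, hη₀⟩)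
    have h2 : f xm ≤ f x' := hxm hx'
    simp only [C] at hC
    linarith

/-- For a positive radius, the infimum in the dual of the worst-case expectation is attained. -/
theorem iSup_ambiguity_le_coe_iff_exists (hp : ∀ k, 0 ≤ D.pbar k) (hsum : ∑ k, D.pbar k = 1)
    (hrho : 0 < D.rho) (s : Fin D.K → ℝ) (η : ℝ) :
    ⨆ p ∈ D.ambiguity, ∑ k, (p k : EReal) * (s k : EReal) ≤ (η : EReal) ↔
      ∃ μ ν : ℝ, 0 ≤ ν ∧ D.dualCost s μ ν ≤ (η : EReal) := by
  rw [D.iSup_ambiguity_le_coe_iff]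
  constructor
  · intro h
    -- With a single decision, zero objective and one constraint, this minimises the dual expression
    -- itself.
    obtain ⟨-, -, η', μ, ν, hν, hle, hmin⟩ := D.exists_min_of_dualCost_le hp hsum hrho
      (isCompact_univ (X := Unit)) Set.univ_nonempty (f := fun _ => 0) continuous_const
      (s := fun (_ : Unit) _ => s) fun _ => continuous_const
    refine ⟨μ, ν, hν, (hle ()).trans (EReal.coe_le_coe_iff.2 (le_of_forall_pos_le_add ?_))⟩
    intro δ hδ
    obtain ⟨μ', ν', hν', h'⟩ := D.exists_dualCost_le_add hp hsum hrho.le hδ h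
    have := hmin () trivial _ μ' ν' hν' fun _ => h'
    linarith
  · rintro ⟨μ, ν, hν, h⟩ p hpa
    exact D.sum_le_of_dualCost_le hp hpa hν h

end TwoStageDRO

/-! ### Recourse costs and the master problem as a relaxation -/

namespace TwoStageDRO

variable (D : TwoStageDRO)

/-- The standing assumptions: nonempty bounded uncertainty subsets, a nominal probability vector,
a nonnegative radius, and relatively complete recourse of finite cost. -/
structure IsRegular : Prop where
  uncSet_nonempty : ∀ k, (D.uncSet k).Nonempty
  isBounded_uncSet : ∀ k, Bornology.IsBounded (D.uncSet k)
  pbar_nonneg : ∀ k, 0 ≤ D.pbar k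
  sum_pbar : ∑ k, D.pbar k = 1
  rho_nonneg : 0 ≤ D.rho
  firstStage_nonempty : D.firstStage.Nonempty
  recourse_nonempty : ∀ x ∈ D.firstStage, ∀ k, ∀ v ∈ D.uncSet k, (D.recourse x v).Nonempty
  bddBelow_recourse : ∀ x ∈ D.firstStage, ∀ k, ∀ v ∈ D.uncSet k,
    BddBelow ((fun y => D.b ⬝ᵥ y) '' D.recourse x v)

/-- The right-hand side of the recourse problem. -/
def rhs (x : Fin D.nx → ℝ) (v : Fin D.nv → ℝ) : Fin D.nh → ℝ := D.h - D.T *ᵥ x - D.M *ᵥ v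

theorem recourse_eq (x : Fin D.nx → ℝ) (v : Fin D.nv → ℝ) :
    D.recourse x v = {y | D.W *ᵥ y ≤ D.rhs x v} := by
  ext y
  simp only [recourse, rhs, Set.mem_ofPred_eq, Pi.le_def, Pi.add_apply, Pi.sub_apply]
  exact forall_congr' fun i => by constructor <;> intro h <;> linarith

/-- The worst recourse costs as real numbers. -/
def cost (x : Fin D.nx → ℝ) (k : Fin D.K) : ℝ := (D.worstCost x k).toReal

variable {D}

theorem mem_recourse_iff {x : Fin D.nx → ℝ} {v : Fin D.nv → ℝ} {y : Fin D.ny → ℝ} :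
    y ∈ D.recourse x v ↔ D.W *ᵥ y ≤ D.rhs x v := by
  rw [recourse_eq]; rfl

theorem neg_dotProduct_rhs_le {l : Fin D.nh → ℝ} (hl : l ∈ Matrix.dualVertices D.W D.b)
    {x : Fin D.nx → ℝ} {v : Fin D.nv → ℝ} {y : Fin D.ny → ℝ} (hy : y ∈ D.recourse x v) :
    -(l ⬝ᵥ D.rhs x v) ≤ D.b ⬝ᵥ y :=
  Matrix.neg_dotProduct_le_of_dualFeasible hl.1 hl.2.1 (mem_recourse_iff.1 hy)

theorem coe_neg_dotProduct_rhs_le_recourseCost {l : Fin D.nh → ℝ}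
    (hl : l ∈ Matrix.dualVertices D.W D.b) (x : Fin D.nx → ℝ) (v : Fin D.nv → ℝ) :
    ((-(l ⬝ᵥ D.rhs x v) : ℝ) : EReal) ≤ D.recourseCost x v :=
  le_iInf₂ fun _ hz => EReal.coe_le_coe_iff.2 (neg_dotProduct_rhs_le hl hz)

theorem recourseCost_eq_of_optimal {x : Fin D.nx → ℝ} {v : Fin D.nv → ℝ} {y : Fin D.ny → ℝ}
    (hy : y ∈ D.recourse x v) (h : ∀ y' ∈ D.recourse x v, D.b ⬝ᵥ y ≤ D.b ⬝ᵥ y') :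
    D.recourseCost x v = ((D.b ⬝ᵥ y : ℝ) : EReal) :=
  le_antisymm (iInf₂_le y hy) (le_iInf₂ fun y' hy' => EReal.coe_le_coe_iff.2 (h y' hy'))

theorem SubOptimal.worstCost_eq {x : Fin D.nx → ℝ} {k : Fin D.K} {v : Fin D.nv → ℝ}
    {y : Fin D.ny → ℝ} (h : D.SubOptimal x k v y) :
    D.worstCost x k = ((D.b ⬝ᵥ y : ℝ) : EReal) := by
  obtain ⟨hv, hy, hmin, hmax⟩ := h
  refine le_antisymm (iSup₂_le hmax) ?_
  rw [← recourseCost_eq_of_optimal hy hmin]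
  exact le_iSup₂ (f := fun v (_ : v ∈ D.uncSet k) => D.recourseCost x v) v hv

theorem SubOptimal.cost_eq {x : Fin D.nx → ℝ} {k : Fin D.K} {v : Fin D.nv → ℝ}
    {y : Fin D.ny → ℝ} (h : D.SubOptimal x k v y) : D.cost x k = D.b ⬝ᵥ y := by
  rw [cost, h.worstCost_eq, EReal.toReal_coe]

/-- If the same dual vertex certifies the worst scenarios of two first-stage decisions, then the
scenario of the first one is also a worst scenario for the second one. -/
theorem SubOptimal.dotProduct_le_of_common_vertex {x x' : Fin D.nx → ℝ} {k : Fin D.K}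
    {v v' : Fin D.nv → ℝ} {y y' y'' : Fin D.ny → ℝ} {l : Fin D.nh → ℝ}
    (hl : l ∈ Matrix.dualVertices D.W D.b)
    (h : D.SubOptimal x k v y) (hly : D.b ⬝ᵥ y = -(l ⬝ᵥ D.rhs x v))
    (h' : D.SubOptimal x' k v' y') (hly' : D.b ⬝ᵥ y' = -(l ⬝ᵥ D.rhs x' v'))
    (hy'' : y'' ∈ D.recourse x' v) : D.b ⬝ᵥ y' ≤ D.b ⬝ᵥ y'' := by
  -- Optimality at `x` gives `l ⬝ᵥ M v' ≤ l ⬝ᵥ M v`. This comparison does not involve `x`, so it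
  -- carries over to `x'`.
  have h1 : ((-(l ⬝ᵥ D.rhs x v') : ℝ) : EReal) ≤ ((D.b ⬝ᵥ y : ℝ) : EReal) :=
    (coe_neg_dotProduct_rhs_le_recourseCost hl x v').trans (h.2.2.2 v' h'.1)
  rw [EReal.coe_le_coe_iff, hly] at h1
  have h2 := neg_dotProduct_rhs_le hl hy''
  rw [hly']
  simp only [rhs, dotProduct_sub] at h1 h2 ⊢
  linarith

theorem isClosed_setOf_mulVec_le {m n : Type*} [Fintype n] (A : Matrix m n ℝ) (q : m → ℝ) :
    IsClosed {x : n → ℝ | A *ᵥ x ≤ q} :=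
  isClosed_le (Continuous.matrix_mulVec continuous_const continuous_id) continuous_const

theorem isClosed_firstStage : IsClosed D.firstStage := by
  have : D.firstStage = {x | D.A *ᵥ x ≤ D.q} ∩ ⋂ j ∈ D.binary, {x | x j = 0 ∨ x j = 1} := by
    ext x; simp [firstStage]
  rw [this]
  refine (isClosed_setOf_mulVec_le _ _).inter (isClosed_iInter fun j => isClosed_iInter fun _ => ?_)
  exact (isClosed_eq (continuous_apply j) continuous_const).union
    (isClosed_eq (continuous_apply j) continuous_const)

namespace IsRegular

variable (H : D.IsRegular)

include H

theorem nonempty_fin : Nonempty (Fin D.K) := by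
  by_contra h
  rw [not_nonempty_iff] at h
  have := H.sum_pbar
  simp at this

/-- The certificates come from one finite set, the same for all `x` and `v`. -/
theorem exists_recourse_vertex {x : Fin D.nx → ℝ} (hx : x ∈ D.firstStage) {k : Fin D.K}
    {v : Fin D.nv → ℝ} (hv : v ∈ D.uncSet k) : ∃ y ∈ D.recourse x v,
      (∀ y' ∈ D.recourse x v, D.b ⬝ᵥ y ≤ D.b ⬝ᵥ y') ∧
      ∃ l ∈ Matrix.dualVertices D.W D.b, D.b ⬝ᵥ y = -(l ⬝ᵥ D.rhs x v) := by
  have h1 := H.recourse_nonempty x hx k v hv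
  have h2 := H.bddBelow_recourse x hx k v hv
  rw [recourse_eq] at h1 h2
  obtain ⟨y, hy, l, hl, hyl⟩ := Matrix.exists_optimal_dualVertex D.W D.b (D.rhs x v) h1 h2
  refine ⟨y, mem_recourse_iff.2 hy, fun y' hy' => ?_, l, hl, hyl⟩
  rw [hyl]
  exact neg_dotProduct_rhs_le hl hy'

theorem dualVertices_nonempty :
    (Matrix.finite_dualVertices D.W D.b).toFinset.Nonempty := by
  obtain ⟨k⟩ := H.nonempty_fin
  obtain ⟨x, hx⟩ := H.firstStage_nonempty
  obtain ⟨v, hv⟩ := H.uncSet_nonempty k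
  obtain ⟨-, -, -, l, hl, -⟩ := H.exists_recourse_vertex hx hv
  exact ⟨l, by simpa using hl⟩

/-- The recourse cost is a continuous function of the decision and the scenario. -/
theorem exists_continuous_recourseCost : ∃ f : (Fin D.nx → ℝ) × (Fin D.nv → ℝ) → ℝ,
    Continuous f ∧ ∀ x ∈ D.firstStage, ∀ k, ∀ v ∈ D.uncSet k,
      D.recourseCost x v = (f (x, v) : EReal) := by
  refine ⟨fun z => (Matrix.finite_dualVertices D.W D.b).toFinset.sup' H.dualVertices_nonempty
    fun l => -(l ⬝ᵥ D.rhs z.1 z.2), ?_, fun x hx k v hv => ?_⟩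
  · refine Continuous.finset_sup'_apply _ fun l _ => ?_
    unfold rhs
    exact (continuous_const.dotProduct ((continuous_const.sub
      (continuous_const.matrix_mulVec continuous_fst)).sub
      (continuous_const.matrix_mulVec continuous_snd))).neg
  · obtain ⟨y, hy, hmin, l, hl, hyl⟩ := H.exists_recourse_vertex hx hv
    rw [recourseCost_eq_of_optimal hy hmin, EReal.coe_eq_coe_iff]
    refine le_antisymm ?_ (Finset.sup'_le _ _ fun l' hl' =>
      neg_dotProduct_rhs_le (by simpa using hl') hy)
    rw [hyl]
    exact Finset.le_sup' (fun l => -(l ⬝ᵥ D.rhs x v)) (by simpa using hl)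

theorem exists_subOptimal {x : Fin D.nx → ℝ} (hx : x ∈ D.firstStage) (k : Fin D.K) :
    ∃ v y, D.SubOptimal x k v y := by
  obtain ⟨f, hf, hfx⟩ := H.exists_continuous_recourseCost
  have hc : IsCompact (D.uncSet k) :=
    Metric.isCompact_of_isClosed_isBounded (isClosed_setOf_mulVec_le _ _) (H.isBounded_uncSet k)
  obtain ⟨v, hv, hmax⟩ := hc.exists_isMaxOn (H.uncSet_nonempty k)
    (f := fun v => f (x, v)) (by fun_prop)
  obtain ⟨y, hy, hmin, -⟩ := H.exists_recourse_vertex hx hv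
  refine ⟨v, y, hv, hy, hmin, fun v' hv' => ?_⟩
  rw [← recourseCost_eq_of_optimal hy hmin, hfx x hx k v hv, hfx x hx k v' hv',
    EReal.coe_le_coe_iff]
  exact hmax hv'

theorem exists_vertex_of_subOptimal {x : Fin D.nx → ℝ} (hx : x ∈ D.firstStage) {k : Fin D.K}
    {v : Fin D.nv → ℝ} {y : Fin D.ny → ℝ} (h : D.SubOptimal x k v y) :
    ∃ l ∈ Matrix.dualVertices D.W D.b, D.b ⬝ᵥ y = -(l ⬝ᵥ D.rhs x v) := by
  obtain ⟨y', hy', hmin, l, hl, hyl⟩ := H.exists_recourse_vertex hx h.1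
  exact ⟨l, hl, hyl ▸ le_antisymm (h.2.2.1 y' hy') (hmin y h.2.1)⟩

/-- The worst cost is attained, hence finite, and `toReal` loses nothing. -/
theorem coe_cost {x : Fin D.nx → ℝ} (hx : x ∈ D.firstStage) (k : Fin D.K) :
    D.worstCost x k = (D.cost x k : EReal) := by
  obtain ⟨v, y, h⟩ := H.exists_subOptimal hx k
  rw [h.cost_eq, h.worstCost_eq]

theorem robustCost_eq {x : Fin D.nx → ℝ} (hx : x ∈ D.firstStage) : D.robustCost x =
    ⨆ p ∈ D.ambiguity, ∑ k, (p k : EReal) * (D.cost x k : EReal) := by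
  simp only [robustCost, H.coe_cost hx]

theorem robustCost_le_of_dualCost_le {x : Fin D.nx → ℝ} (hx : x ∈ D.firstStage) {μ ν η : ℝ}
    (hν : 0 ≤ ν) (h : D.dualCost (D.cost x) μ ν ≤ (η : EReal)) : D.robustCost x ≤ (η : EReal) := by
  rw [H.robustCost_eq hx, iSup_ambiguity_le_coe_iff]
  exact fun p hp => D.sum_le_of_dualCost_le H.pbar_nonneg hp hν h

/-- The recourse costs of scenarios in the uncertainty subsets are at most the worst costs. -/
theorem exists_recourse_le_cost {x : Fin D.nx → ℝ} (hx : x ∈ D.firstStage) {k : Fin D.K}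
    {v : Fin D.nv → ℝ} (hv : v ∈ D.uncSet k) : ∃ y ∈ D.recourse x v, D.b ⬝ᵥ y ≤ D.cost x k := by
  obtain ⟨y, hy, hmin, -⟩ := H.exists_recourse_vertex hx hv
  refine ⟨y, hy, ?_⟩
  rw [← EReal.coe_le_coe_iff, ← H.coe_cost hx, ← recourseCost_eq_of_optimal hy hmin]
  exact le_iSup₂ (f := fun v (_ : v ∈ D.uncSet k) => D.recourseCost x v) v hv

/-- The master problem is a relaxation of the dual reformulation. -/
theorem le_of_masterOptimal {r : ℕ} {cut : ℕ → Fin D.K → Fin D.nv → ℝ}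
    (hcut : ∀ i < r, ∀ k, cut i k ∈ D.uncSet k) {x : Fin D.nx → ℝ} {η μ ν : ℝ}
    (h : D.MasterOptimal r cut x η μ ν) {x' : Fin D.nx → ℝ} (hx' : x' ∈ D.firstStage)
    {η' μ' ν' : ℝ} (hν' : 0 ≤ ν') (hle : D.dualCost (D.cost x') μ' ν' ≤ (η' : EReal)) :
    D.c ⬝ᵥ x + η ≤ D.c ⬝ᵥ x' + η' := by
  have hy : ∀ i k, ∃ y, i < r → y ∈ D.recourse x' (cut i k) ∧ D.b ⬝ᵥ y ≤ D.cost x' k :=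
    fun i k => by
      by_cases hi : i < r
      · obtain ⟨y, hy, hyc⟩ := H.exists_recourse_le_cost hx' (hcut i hi k)
        exact ⟨y, fun _ => ⟨hy, hyc⟩⟩
      · exact ⟨0, fun h => absurd h hi⟩
  choose y hy using hy
  exact h.2 x' η' μ' ν' y ⟨hx', hν', fun i hi =>
    (D.dualCost_mono H.pbar_nonneg (fun k => (hy i k hi).2) _ _).trans hle,
    fun i hi k => (hy i k hi).1⟩

/-- The error `δ` covers `rho = 0`, where a feasible `η'` may have no exact dual multipliers. -/
theorem le_of_masterOptimal_of_feasible {r : ℕ} {cut : ℕ → Fin D.K → Fin D.nv → ℝ}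
    (hcut : ∀ i < r, ∀ k, cut i k ∈ D.uncSet k) {x : Fin D.nx → ℝ} {η μ ν : ℝ}
    (h : D.MasterOptimal r cut x η μ ν) {x' : Fin D.nx → ℝ} {η' : ℝ} (hf : D.Feasible x' η') :
    D.c ⬝ᵥ x + η ≤ D.c ⬝ᵥ x' + η' := by
  obtain ⟨hx', hle⟩ := hf
  rw [H.robustCost_eq hx', iSup_ambiguity_le_coe_iff] at hle
  refine le_of_forall_pos_le_add fun δ hδ => ?_
  obtain ⟨μ', ν', hν', h'⟩ :=
    D.exists_dualCost_le_add H.pbar_nonneg H.sum_pbar H.rho_nonneg hδ hle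
  have := H.le_of_masterOptimal hcut h hx' hν' h'
  linarith

/-- For a positive radius and bounded first-stage decisions, master problems with cuts are
solvable. -/
theorem exists_masterOptimal (hrho : 0 < D.rho) (hb : Bornology.IsBounded D.firstStage) {r : ℕ}
    (hr : 0 < r) {cut : ℕ → Fin D.K → Fin D.nv → ℝ}
    (hcut : ∀ i < r, ∀ k, cut i k ∈ D.uncSet k) :
    ∃ x η μ ν, D.MasterOptimal r cut x η μ ν := by
  obtain ⟨f, hf, hfx⟩ := H.exists_continuous_recourseCost
  have : Nonempty (Fin r) := ⟨⟨0, hr⟩⟩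
  -- By monotonicity of the dual expression the recourse vectors can be eliminated: each cut enters
  -- through its optimal recourse cost, which is continuous in `x`.
  obtain ⟨x, hx, η, μ, ν, hν, hle, hmin⟩ := D.exists_min_of_dualCost_le H.pbar_nonneg H.sum_pbar
    hrho (Metric.isCompact_of_isClosed_isBounded isClosed_firstStage hb) H.firstStage_nonempty
    (f := fun x => D.c ⬝ᵥ x) (continuous_const.dotProduct continuous_id)
    (s := fun (i : Fin r) x k => f (x, cut i k)) (fun i => by fun_prop)
  have hy : ∀ i k, ∃ y, i < r → y ∈ D.recourse x (cut i k) ∧ D.b ⬝ᵥ y = f (x, cut i k) :=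
    fun i k => by
      by_cases hi : i < r
      · obtain ⟨y, hy, hymin, -⟩ := H.exists_recourse_vertex hx (hcut i hi k)
        have := recourseCost_eq_of_optimal hy hymin
        rw [hfx x hx k _ (hcut i hi k), EReal.coe_eq_coe_iff] at this
        exact ⟨y, fun _ => ⟨hy, this.symm⟩⟩
      · exact ⟨0, fun h => absurd h hi⟩
  choose y hy using hy
  refine ⟨x, η, μ, ν, ⟨y, hx, hν, fun i hi => ?_, fun i hi k => (hy i k hi).1⟩, ?_⟩
  · have := hle ⟨i, hi⟩
    rwa [show (fun k => f (x, cut i k)) = fun k => D.b ⬝ᵥ y i k from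
      funext fun k => (hy i k hi).2.symm] at this
  · rintro x' η' μ' ν' y' ⟨hx', hν', hle', hrec'⟩
    refine hmin x' hx' η' μ' ν' hν' fun i =>
      (D.dualCost_mono H.pbar_nonneg (fun k => ?_) _ _).trans (hle' i i.2)
    rw [← EReal.coe_le_coe_iff, ← hfx x' hx' k _ (hcut i i.2 k)]
    exact iInf₂_le (y' i k) (hrec' i i.2 k)

end IsRegular

end TwoStageDRO

/-! ### Runs of the algorithm: bounds, termination and output -/

namespace TwoStageDRO

variable {D : TwoStageDRO}

/-- This and the following congruences express dependence on earlier entries only, so that a run can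
be extended by overwriting entry `n`. -/
theorem UB_congr {t t' : ℕ → D.Iterate} {n : ℕ} (h : ∀ i < n, t' i = t i) :
    D.UB t' n = D.UB t n := by
  induction n with
  | zero => rfl
  | succ n ih => rw [UB, UB, ih fun i hi => h i (hi.trans n.lt_succ_self), h n n.lt_succ_self]

theorem LB_congr {t t' : ℕ → D.Iterate} {n : ℕ} (h : ∀ i < n, t' i = t i) :
    D.LB t' n = D.LB t n := by
  cases n with
  | zero => rfl
  | succ n => rw [LB, LB, h n n.lt_succ_self]

theorem gapOpen_congr {t t' : ℕ → D.Iterate} {n : ℕ} (h : ∀ i < n, t' i = t i) {ε : ℝ} :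
    D.GapOpen ε t' n ↔ D.GapOpen ε t n := by
  rw [GapOpen, GapOpen, UB_congr h, LB_congr h]

theorem masterFeasible_congr {r : ℕ} {cut cut' : ℕ → Fin D.K → Fin D.nv → ℝ}
    (h : ∀ i < r, cut' i = cut i) {x : Fin D.nx → ℝ} {η μ ν : ℝ}
    {y : ℕ → Fin D.K → Fin D.ny → ℝ} :
    D.MasterFeasible r cut' x η μ ν y ↔ D.MasterFeasible r cut x η μ ν y := by
  unfold MasterFeasible
  refine and_congr_right fun _ => and_congr_right fun _ => and_congr_right fun _ => ?_
  exact forall₂_congr fun i hi => by rw [h i hi]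

theorem masterReturns_congr {r : ℕ} {cut cut' : ℕ → Fin D.K → Fin D.nv → ℝ}
    (h : ∀ i < r, cut' i = cut i) {x : Fin D.nx → ℝ} {η μ ν : ℝ} :
    D.MasterReturns r cut' x η μ ν ↔ D.MasterReturns r cut x η μ ν := by
  simp only [MasterReturns, MasterOptimal, masterFeasible_congr h]

theorem MasterReturns.exists_feasible {r : ℕ} {cut : ℕ → Fin D.K → Fin D.nv → ℝ}
    {x : Fin D.nx → ℝ} {η μ ν : ℝ} (h : D.MasterReturns r cut x η μ ν) :
    ∃ y, D.MasterFeasible r cut x η μ ν y := by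
  unfold MasterReturns at h
  split_ifs at h with hr
  · exact h
  · exact h.1

theorem MasterReturns.optimal {r : ℕ} {cut : ℕ → Fin D.K → Fin D.nv → ℝ}
    {x : Fin D.nx → ℝ} {η μ ν : ℝ} (h : D.MasterReturns r cut x η μ ν) (hr : r ≠ 0) :
    D.MasterOptimal r cut x η μ ν := by
  rwa [MasterReturns, if_neg hr] at h

theorem not_gapOpen_of_eq {t : ℕ → D.Iterate} {n : ℕ} {z : ℝ} (hU : D.UB t n = (z : EReal))
    (hL : D.LB t n = (z : EReal)) (ε : ℝ) : ¬ D.GapOpen ε t n := by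
  rw [GapOpen, hU, hL, EReal.sub_self (EReal.coe_ne_top _) (EReal.coe_ne_bot _), EReal.abs_zero]
  exact not_lt_bot

theorem LB_succ_of_ne_zero (t : ℕ → D.Iterate) {r : ℕ} (hr : r ≠ 0) :
    D.LB t (r + 1) = ((D.c ⬝ᵥ (t r).x + (t r).η : ℝ) : EReal) := by
  rw [LB, if_neg hr]

theorem UB_ne_bot (hp : ∀ k, 0 ≤ D.pbar k) (t : ℕ → D.Iterate) (n : ℕ) : D.UB t n ≠ ⊥ := by
  induction n with
  | zero => exact top_ne_bot
  | succ n ih =>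
    rw [UB]
    rcases min_choice (D.UB t n) (D.candidate (t n)) with h | h <;> rw [h]
    · exact ih
    · exact EReal.add_ne_bot_iff.2 ⟨EReal.coe_ne_bot _, D.dualCost_ne_bot hp _ _ _⟩

theorem exists_UB_eq_candidate (t : ℕ → D.Iterate) {n : ℕ} (hn : 0 < n) :
    ∃ j < n, D.UB t n = D.candidate (t j) := by
  obtain ⟨n, rfl⟩ := Nat.exists_eq_succ_of_ne_zero hn.ne'
  induction n with
  | zero => exact ⟨0, hn, min_eq_right le_top⟩
  | succ n ih =>
    rw [Nat.succ_eq_add_one, UB]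
    rcases min_choice (D.UB t (n + 1)) (D.candidate (t (n + 1))) with h | h <;> rw [h]
    · obtain ⟨j, hj, hU⟩ := ih n.succ_pos
      exact ⟨j, hj.trans (Nat.lt_succ_self _), hU⟩
    · exact ⟨n + 1, Nat.lt_succ_self _, rfl⟩

/-- The loop is entered again after the master problem without cuts. -/
theorem gapOpen_of_le_one (hp : ∀ k, 0 ≤ D.pbar k) (ε : ℝ) (t : ℕ → D.Iterate) {n : ℕ}
    (hn : n ≤ 1) : D.GapOpen ε t n := by
  have hL : D.LB t n = ⊥ := by
    interval_cases n <;> rfl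
  rw [GapOpen, hL, EReal.sub_bot (UB_ne_bot hp t n), EReal.abs_top]
  exact ENNReal.ofReal_lt_top

namespace IsRun

variable {ε : ℝ} {n : ℕ} {t : ℕ → D.Iterate} (hrun : D.IsRun ε n t)

include hrun

theorem mem_firstStage {r : ℕ} (hr : r < n) : (t r).x ∈ D.firstStage := by
  obtain ⟨y, hy⟩ := (hrun r hr).2.1.exists_feasible
  exact hy.1

theorem nu_nonneg {r : ℕ} (hr : r < n) : 0 ≤ (t r).ν := by
  obtain ⟨y, hy⟩ := (hrun r hr).2.1.exists_feasible
  exact hy.2.1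

theorem subOptimal {r : ℕ} (hr : r < n) (k : Fin D.K) :
    D.SubOptimal (t r).x k ((t r).v k) ((t r).y k) := (hrun r hr).2.2 k

theorem cut_mem {r : ℕ} (hr : r ≤ n) : ∀ i < r, ∀ k, (t i).v k ∈ D.uncSet k :=
  fun _ hi k => (hrun.subOptimal (hi.trans_le hr) k).1

theorem candidate_eq {r : ℕ} (hr : r < n) : D.candidate (t r) =
    ((D.c ⬝ᵥ (t r).x : ℝ) : EReal) + D.dualCost (D.cost (t r).x) (t r).μ (t r).ν := by
  rw [candidate, show D.cost (t r).x = fun k => D.b ⬝ᵥ (t r).y k from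
    funext fun k => (hrun.subOptimal hr k).cost_eq]

/-- The multipliers of iteration `j`, taken with the true worst costs, give points of the dual
reformulation, which every master problem relaxes; so `i` and `j` may come in any order. -/
theorem LB_le_candidate (H : D.IsRegular) {i j : ℕ} (hi : i ≤ n) (hj : j < n) :
    D.LB t i ≤ D.candidate (t j) := by
  rcases i with _ | i
  · exact bot_le
  rcases eq_or_ne i 0 with rfl | hi0
  · exact bot_le
  rw [LB_succ_of_ne_zero t hi0, hrun.candidate_eq hj]
  -- The candidate may be `⊤`, so it is approached by real numbers above it.
  refine EReal.le_of_forall_lt_iff_le.1 fun z hz => EReal.coe_le_coe_iff.2 ?_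
  have hle : D.dualCost (D.cost (t j).x) (t j).μ (t j).ν ≤ ((z - D.c ⬝ᵥ (t j).x : ℝ) : EReal) := by
    rw [EReal.coe_sub, EReal.le_sub_iff_add_le (Or.inl (EReal.coe_ne_bot _))
      (Or.inl (EReal.coe_ne_top _)), add_comm]
    exact hz.le
  have := H.le_of_masterOptimal (hrun.cut_mem (Nat.le_of_succ_le hi))
    ((hrun i hi).2.1.optimal hi0) (hrun.mem_firstStage hj) (hrun.nu_nonneg hj) hle
  linarith

theorem LB_le_UB (H : D.IsRegular) : D.LB t n ≤ D.UB t n := by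
  rcases n.eq_zero_or_pos with rfl | hn
  · exact bot_le
  obtain ⟨j, hj, hU⟩ := exists_UB_eq_candidate t hn
  exact hU ▸ hrun.LB_le_candidate H le_rfl hj

/-- If the master problem of an iteration already contains worst scenarios for its solution, then
the lower bound reaches the upper bound in this iteration. -/
theorem candidate_le_LB (H : D.IsRegular) {i r : ℕ} (hir : i < r) (hr : r < n)
    (h : ∀ k, ∀ y ∈ D.recourse (t r).x ((t i).v k), D.b ⬝ᵥ (t r).y k ≤ D.b ⬝ᵥ y) :
    D.candidate (t r) ≤ D.LB t (r + 1) := by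
  have hr0 : r ≠ 0 := (Nat.zero_le i).trans_lt hir |>.ne'
  obtain ⟨y, hy⟩ := (hrun r hr).2.1.exists_feasible
  rw [LB_succ_of_ne_zero t hr0, candidate, EReal.coe_add]
  -- The master's own recourse vectors for cut `i` cost at least the subproblem values, and their
  -- dual expression is at most `η`.
  exact add_le_add le_rfl ((D.dualCost_mono H.pbar_nonneg
    (fun k => h k _ (hy.2.2.2 i hir k)) _ _).trans (hy.2.2.1 i hir))

theorem mono {m : ℕ} (h : m ≤ n) : D.IsRun ε m t := fun r hr => hrun r (hr.trans_le h)

/-- The number of iterations is at most one more than the number of tuples of dual vertices. -/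
theorem le_card (H : D.IsRegular) : n ≤
    Nat.card (Fin D.K → Matrix.dualVertices D.W D.b) + 1 := by
  have hfin : Finite (Matrix.dualVertices D.W D.b) := Matrix.finite_dualVertices D.W D.b
  by_contra! hlt
  set N := Nat.card (Fin D.K → Matrix.dualVertices D.W D.b) + 1 with hN
  have hvert : ∀ (r : Fin N) (k : Fin D.K), ∃ l : Matrix.dualVertices D.W D.b,
      D.b ⬝ᵥ (t r).y k = -(l.1 ⬝ᵥ D.rhs (t r).x ((t r).v k)) := fun r k => by
    obtain ⟨l, hl, h⟩ := H.exists_vertex_of_subOptimal (hrun.mem_firstStage (r.2.trans hlt))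
      (hrun.subOptimal (r.2.trans hlt) k)
    exact ⟨⟨l, hl⟩, h⟩
  choose l hl using hvert
  have hninj : ¬ Function.Injective l := fun hinj => by
    have := Nat.card_le_card_of_injective l hinj
    rw [Nat.card_fin] at this
    omega
  obtain ⟨i, r, hir, heq⟩ : ∃ i r : Fin N, i < r ∧ l i = l r := by
    simp only [Function.Injective, not_forall] at hninj
    obtain ⟨i, r, heq, hne⟩ := hninj
    rcases lt_or_gt_of_ne hne with h | h
    · exact ⟨i, r, h, heq⟩
    · exact ⟨r, i, h, heq.symm⟩
  -- The repetition occurs among the first `N < n` iterations, so iteration `r + 1` was entered with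
  -- an open gap although the bounds had met.
  have hrn : (r : ℕ) + 1 < n := lt_of_le_of_lt r.2 hlt
  have hr0 : (r : ℕ) ≠ 0 := (Nat.zero_le (i : ℕ)).trans_lt hir |>.ne'
  have hle := hrun.candidate_le_LB H (i := i) (r := r) hir (r.2.trans hlt) fun k y hy =>
    SubOptimal.dotProduct_le_of_common_vertex (l i k).2
      (hrun.subOptimal (i.2.trans hlt) k) (hl i k)
      (hrun.subOptimal (r.2.trans hlt) k) (heq ▸ hl r k) hy
  have hUL : D.UB t (r + 1) = D.LB t (r + 1) :=
    le_antisymm ((min_le_right _ _).trans hle) ((hrun.mono hrn.le).LB_le_UB H)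
  have hL := LB_succ_of_ne_zero t hr0
  exact not_gapOpen_of_eq (hUL.trans hL) hL ε (hrun _ hrn).1

/-- The loop goes on as long as the master problem can be solved. -/
theorem exists_extension (H : D.IsRegular) (hgap : D.GapOpen ε t n)
    (h : n = 0 ∨ ∃ x η μ ν, D.MasterOptimal n (fun i => (t i).v) x η μ ν) :
    ∃ t' : ℕ → D.Iterate, (∀ i < n, t' i = t i) ∧ D.IsRun ε (n + 1) t' := by
  obtain ⟨x, η, μ, ν, hret⟩ : ∃ x η μ ν, D.MasterReturns n (fun i => (t i).v) x η μ ν := by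
    by_cases hn : n = 0
    · obtain ⟨x, hx⟩ := H.firstStage_nonempty
      subst hn
      exact ⟨x, 0, 0, 0, by
        rw [MasterReturns, if_pos rfl]
        exact ⟨fun _ _ => 0, hx, le_rfl, fun i hi => absurd hi i.not_lt_zero,
          fun i hi => absurd hi i.not_lt_zero⟩⟩
    · obtain ⟨x, η, μ, ν, h⟩ := h.resolve_left hn
      exact ⟨x, η, μ, ν, by rwa [MasterReturns, if_neg hn]⟩
  obtain ⟨-, hx, -⟩ := hret.exists_feasible
  choose v y hvy using fun k => H.exists_subOptimal hx k
  have heq : ∀ i < n, Function.update t n ⟨x, η, μ, ν, v, y⟩ i = t i :=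
    fun i hi => Function.update_of_ne hi.ne _ _
  refine ⟨_, heq, fun r hr => ?_⟩
  have hle := Nat.lt_succ_iff.1 hr
  rw [gapOpen_congr fun i hi => heq i (hi.trans_le hle),
    masterReturns_congr (cut := fun i => (t i).v)
      fun i hi => by rw [heq i (hi.trans_le hle)]]
  rcases hle.lt_or_eq with hlt | rfl
  · rw [heq r hlt]
    exact hrun r hlt
  · rw [Function.update_self]
    exact ⟨hgap, hret, hvy⟩

/-- Stopping requires at least two iterations, so the last lower bound is a real number. -/
theorem exists_returns (H : D.IsRegular) (hgap : ¬ D.GapOpen ε t n) :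
    ∃ x val, D.Returns ε n t x val := by
  have hn : 1 < n := not_le.1 fun h => hgap (gapOpen_of_le_one H.pbar_nonneg ε t h)
  obtain ⟨j, hj, hU⟩ := exists_UB_eq_candidate t (zero_lt_one.trans hn)
  obtain ⟨r, rfl⟩ := Nat.exists_eq_succ_of_ne_zero (zero_lt_one.trans hn).ne'
  exact ⟨_, _, hrun, hgap, LB_succ_of_ne_zero t (by omega), j, hj, hU, rfl⟩

end IsRun

/-- The lower bound is a lower bound for the distributionally robust problem. -/
theorem IsRun.le_of_feasible {ε : ℝ} {n : ℕ} {t : ℕ → D.Iterate} (hrun : D.IsRun ε n t)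
    (H : D.IsRegular) {z : ℝ} (hz : D.LB t n = (z : EReal)) {x : Fin D.nx → ℝ} {η : ℝ}
    (hf : D.Feasible x η) : z ≤ D.c ⬝ᵥ x + η := by
  rcases n with _ | r
  · exact absurd hz (EReal.bot_ne_coe z)
  rcases eq_or_ne r 0 with rfl | hr0
  · exact absurd hz (EReal.bot_ne_coe z)
  rw [LB_succ_of_ne_zero t hr0, EReal.coe_eq_coe_iff] at hz
  rw [← hz]
  exact H.le_of_masterOptimal_of_feasible (hrun.cut_mem r.le_succ)
    ((hrun r r.lt_succ_self).2.1.optimal hr0) hf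

theorem le_add_of_not_gapOpen {ε : ℝ} (hε : 0 ≤ ε) {n : ℕ} {t : ℕ → D.Iterate} {z : ℝ}
    (hz : D.LB t n = (z : EReal)) (h : ¬ D.GapOpen ε t n) :
    D.UB t n ≤ ((z + ε : ℝ) : EReal) := by
  rw [GapOpen, hz, not_lt] at h
  induction hU : D.UB t n with
  | bot => exact bot_le
  | top => rw [hU, EReal.top_sub_coe, EReal.abs_top] at h; simp at h
  | coe u =>
    rw [hU, ← EReal.coe_sub, EReal.abs_def, ENNReal.ofReal_le_ofReal_iff hε] at h
    rw [EReal.coe_le_coe_iff]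
    linarith [le_abs_self (u - z)]

/-- The decision and the value that the algorithm returns. -/
theorem Returns.isEpsOptimal (H : D.IsRegular) {ε : ℝ} (hε : 0 ≤ ε) {n : ℕ}
    {t : ℕ → D.Iterate} {x : Fin D.nx → ℝ} {z : ℝ} (h : D.Returns ε n t x z) :
    (∃ η, D.IsEpsOptimal ε x η ∧ D.c ⬝ᵥ x + η ≤ z + ε) ∧
      (z : EReal) ≤ D.optValue ∧ D.optValue ≤ ((z + ε : ℝ) : EReal) := by
  obtain ⟨hrun, hgap, hz, j, hj, hU, rfl⟩ := h
  have hle := le_add_of_not_gapOpen hε hz hgap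
  rw [hU, hrun.candidate_eq hj] at hle
  have hdual : D.dualCost (D.cost (t j).x) (t j).μ (t j).ν ≤
      ((z + ε - D.c ⬝ᵥ (t j).x : ℝ) : EReal) := by
    rw [EReal.coe_sub, EReal.le_sub_iff_add_le (Or.inl (EReal.coe_ne_bot _))
      (Or.inl (EReal.coe_ne_top _)), add_comm]
    exact hle
  -- This `η` makes the objective exactly `z + ε`. The multipliers of iteration `j` certify
  -- feasibility by weak duality, even if `j` is not the last iteration.
  have hfeas : D.Feasible (t j).x (z + ε - D.c ⬝ᵥ (t j).x) :=
    ⟨hrun.mem_firstStage hj,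
      H.robustCost_le_of_dualCost_le (hrun.mem_firstStage hj) (hrun.nu_nonneg hj) hdual⟩
  refine ⟨⟨_, ⟨hfeas, fun x' η' hf => ?_⟩, by linarith⟩, ?_, ?_⟩
  · linarith [hrun.le_of_feasible H hz hf]
  · exact le_iInf fun x' => le_iInf fun η' => le_iInf fun hf =>
      EReal.coe_le_coe_iff.2 (hrun.le_of_feasible H hz hf)
  · have hopt : D.optValue ≤
        ((D.c ⬝ᵥ (t j).x + (z + ε - D.c ⬝ᵥ (t j).x) : ℝ) : EReal) := by
      unfold optValue
      exact iInf_le_of_le (t j).x (iInf_le_of_le _ (iInf_le _ hfeas))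
    rwa [add_sub_cancel] at hopt

end TwoStageDRO

end

theorem theorem2 (D : TwoStageDRO)
    -- every uncertainty subset is a nonempty bounded polytope
    (hne : ∀ k, (D.uncSet k).Nonempty)
    (hbd : ∀ k, Bornology.IsBounded (D.uncSet k))
    -- the nominal vector is a probability vector and the radius is nonnegative
    (hp_nonneg : ∀ k, 0 ≤ D.pbar k) (hp_sum : ∑ k, D.pbar k = 1) (hrho : 0 ≤ D.rho)
    -- there is a first-stage decision, recourse is relatively complete and has finite cost
    (hX : D.firstStage.Nonempty)
    (hrec : ∀ x ∈ D.firstStage, ∀ k, ∀ v ∈ D.uncSet k, (D.recourse x v).Nonempty)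
    (hfin : ∀ x ∈ D.firstStage, ∀ k, ∀ v ∈ D.uncSet k,
      BddBelow ((fun y => D.b ⬝ᵥ y) '' D.recourse x v)) :
    -- the max-min subproblems are solvable, and their value is the worst-case cost
    (∀ x ∈ D.firstStage, ∀ k, ∃ v y, D.SubOptimal x k v y ∧
      D.worstCost x k = ((D.b ⬝ᵥ y : ℝ) : EReal)) ∧
    -- the dual reformulation of the worst-case expectation
    (∀ x ∈ D.firstStage, D.robustCost x =
      ⨅ (μ : ℝ) (ν : ℝ) (_ : 0 ≤ ν), D.dualCost (fun k => (D.worstCost x k).toReal) μ ν) ∧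
    (0 < D.rho → ∀ x ∈ D.firstStage, ∀ η : ℝ, D.robustCost x ≤ (η : EReal) ↔
      ∃ μ ν : ℝ, 0 ≤ ν ∧ D.dualCost (fun k => (D.worstCost x k).toReal) μ ν ≤ (η : EReal)) ∧
    -- the number of iterations is bounded, for all tolerances and all choices of the solvers
    (∃ N : ℕ, ∀ ε : ℝ, 0 ≤ ε → ∀ n t, D.IsRun ε n t → n ≤ N) ∧
    -- the algorithm gets stuck only if a master problem with cuts has no optimal solution,
    (∀ ε : ℝ, 0 ≤ ε → ∀ n t, D.IsRun ε n t → D.GapOpen ε t n →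
      (n = 0 ∨ ∃ x η μ ν, D.MasterOptimal n (fun i => (t i).v) x η μ ν) →
      ∃ t', (∀ i < n, t' i = t i) ∧ D.IsRun ε (n + 1) t') ∧
    -- which cannot happen for a positive radius and bounded first-stage decisions
    (0 < D.rho → Bornology.IsBounded D.firstStage → ∀ ε : ℝ, 0 ≤ ε → ∀ n t, D.IsRun ε n t →
      0 < n → ∃ x η μ ν, D.MasterOptimal n (fun i => (t i).v) x η μ ν) ∧
    -- when the loop condition fails, the algorithm returns a decision and a value,
    (∀ ε : ℝ, 0 ≤ ε → ∀ n t, D.IsRun ε n t → ¬ D.GapOpen ε t n →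
      ∃ x val, D.Returns ε n t x val) ∧
    -- and whatever it returns solves the distributionally robust problem up to the tolerance
    (∀ ε : ℝ, 0 ≤ ε → ∀ n t x val, D.Returns ε n t x val →
      (∃ η, D.IsEpsOptimal ε x η ∧ D.c ⬝ᵥ x + η ≤ val + ε) ∧
        (val : EReal) ≤ D.optValue ∧ D.optValue ≤ ((val + ε : ℝ) : EReal)) := by
  have H : D.IsRegular := ⟨hne, hbd, hp_nonneg, hp_sum, hrho, hX, hrec, hfin⟩
  refine ⟨fun x hx k => ?_, fun x hx => ?_, fun hpos x hx η => ?_,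
    ⟨_, fun ε _ n t hrun => hrun.le_card H⟩,
    fun ε _ n t hrun hgap h => hrun.exists_extension H hgap h,
    fun hpos hb ε _ n t hrun hn => H.exists_masterOptimal hpos hb hn (hrun.cut_mem le_rfl),
    fun ε _ n t hrun hgap => hrun.exists_returns H hgap,
    fun ε hε n t x val h => h.isEpsOptimal H hε⟩
  · obtain ⟨v, y, h⟩ := H.exists_subOptimal hx k
    exact ⟨v, y, h, h.worstCost_eq⟩
  · rw [H.robustCost_eq hx]
    exact D.iSup_ambiguity_eq_iInf_dualCost hp_nonneg hp_sum hrho _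
  · rw [H.robustCost_eq hx]
    exact D.iSup_ambiguity_le_coe_iff_exists hp_nonneg hp_sum hpos _ η
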